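/- Let $M\ge 1$ and $d_1,\dots,d_M\ge 1$ be integers, $d=d_1+\dots+d_M$, and write $x=(x_1,\dots,x_M)\in\mathbb{R}^d$ with blocks $x_m\in\mathbb{R}^{d_m}$; $x_{-m}$ denotes the blocks of $x$ other than $x_m$. Let $\pi(\mathrm{d}x)=e^{-U(x)}\,\mathrm{d}x$ be a probability measure on $\mathbb{R}^d$. For each $m$ let $P_m$ be the Markov kernel that replaces $x_m$ by a draw from the conditional law $\pi(\cdot\mid x_{-m})$ and leaves the other blocks unchanged, let $P^{\mathrm{GS}}=\frac1M\sum_{m=1}^M P_m$ be the random-scan Gibbs sampler, and let $\mu^{(n+1)}=\mu^{(n)}P^{\mathrm{GS}}$ be the law of the chain started from $\mu^{(0)}$. $\mathrm{KL}(\mu|\pi)$ denotes the Kullback–Leibler divergence. Block-wise assumption: $U(x)=U_0(x)+\sum_{m=1}^M U_m(x_m)$, where each $U_m:\mathbb{R}^{d_m}\to\mathbb{R}$ is convex, $U_0$ is $C^1$, and there are $L_1,\dots,L_M>0$ and $\lambda^*>0$ such that for every $m$ and every fixed $\bar x_{-m}$ the map $x_m\mapsto\nabla_m U_0(x_m,\bar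 x_{-m})$ is $L_m$-Lipschitz, and $x\mapsto U_0(x)-\frac{\lambda^*}{2}\sum_m L_m\|x_m\|^2$ is convex. In this case put $\kappa^*=1/\lambda^*$. Global assumption: $U$ is convex and differentiable, $\nabla U$ is $L$-Lipschitz, and $x\mapsto U(x)-\frac{\lambda}{2}\|x\|^2$ is convex with $\lambda>0$. In this case put $\kappa=L/\lambda$. Let $\epsilon>0$. With the convention $\log 0=-\infty$ (so that for $C=1$ in (a), and for $\kappa=1$ in (b), the conclusion holds for every $n\ge 0$): (a) (Warm start) If the block-wise assumption holds and $\mu^{(0)}$ is a probability measure such that, for some real $C$, $\mu^{(0)}(A)\le C\,\pi(A)$ for all Borel sets $A$, then $\mathrm{KL}(\mu^{(n)}|\pi)\le\epsilon$ for every integer $n\ge 0$ with $$n\ \ge\ \kappa^* M\left[\log\frac1\epsilon+\log\log C\right].$$ (b) (Feasible start) If the global assumption holds, then $U$ has a unique minimizer $x^*$ (the mode of $\pi$), the block-wise assumption holds for some decomposition with $1\le\kappa^*\le\kappa$, and, for every decomposition of $U$ as in the block-wise assumption, with the corresponding $\kappa^*$, if $\mu^{(0)}=N(x^*,L^{-1}\mathrm{Id}_d)$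 then $\mathrm{KL}(\mu^{(n)}|\pi)\le\epsilon$ for every integer $n\ge 0$ with $$n\ \ge\ \kappa^* M\left[\log\frac1\epsilon+\log\left(\frac{d\log\kappa}{2}\right)\right].$$ -/

import Mathlib

open MeasureTheory ProbabilityTheory

noncomputable section

/-- The space `ℝ^d = ℝ^{d_1} × ⋯ × ℝ^{d_M}`, with its Euclidean structure
`‖x‖² = ∑ m, ‖x m‖²`; the `m`-th block of `x` is `x m`. -/
abbrev BlockSpace {M : ℕ} (d : Fin M → ℕ) : Type :=
  PiLp 2 (fun m : Fin M => EuclideanSpace ℝ (Fin (d m)))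

/-- The space `∏_{i ≠ m} ℝ^{d_i}` of the blocks other than the `m`-th one. -/
abbrev OtherBlocks {M : ℕ} (d : Fin M → ℕ) (m : Fin M) : Type :=
  (i : {i : Fin M // i ≠ m}) → EuclideanSpace ℝ (Fin (d i))

/-- `x ↦ x_{-m}`. -/
def dropBlock {M : ℕ} {d : Fin M → ℕ} (m : Fin M) (x : BlockSpace d) : OtherBlocks d m :=
  fun i => x i

/-- `(y, x_{-m})`: the point `x` with its `m`-th block replaced by `y`. -/
def replaceBlock {M : ℕ} {d : Fin M → ℕ} (m : Fin M) (y : EuclideanSpace ℝ (Fin (d m)))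
    (x : BlockSpace d) : BlockSpace d :=
  WithLp.toLp 2 (Function.update (WithLp.ofLp x) m y)

theorem measurable_dropBlock {M : ℕ} {d : Fin M → ℕ} (m : Fin M) :
    Measurable (dropBlock (d := d) m) := by
  unfold dropBlock
  fun_prop

theorem measurable_replaceBlock {M : ℕ} {d : Fin M → ℕ} (m : Fin M) :
    Measurable (fun p : BlockSpace d × EuclideanSpace ℝ (Fin (d m)) =>
      replaceBlock m p.2 p.1) := by
  unfold replaceBlock
  refine (WithLp.measurable_toLp 2 _).comp ?_
  refine measurable_pi_lambda _ fun i => ?_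
  by_cases h : i = m
  · subst h
    simpa using measurable_snd
  · simp only [Function.update_of_ne h]
    fun_prop

/-- The full conditional `π(· | x_{-m})`: the regular conditional distribution of the block `X_m`
given `X_{-m}` when `X ∼ π`. -/
def fullConditional {M : ℕ} {d : Fin M → ℕ} (π : Measure (BlockSpace d)) [IsFiniteMeasure π]
    (m : Fin M) : Kernel (OtherBlocks d m) (EuclideanSpace ℝ (Fin (d m))) :=
  condDistrib (fun x : BlockSpace d => x m) (dropBlock m) π

/-- The kernel `P_m`: the block `x_m` is redrawn from `π(· | x_{-m})`, the other blocks of `x` are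
kept. -/
def blockUpdateKernel {M : ℕ} {d : Fin M → ℕ} (π : Measure (BlockSpace d)) [IsFiniteMeasure π]
    (m : Fin M) : Kernel (BlockSpace d) (BlockSpace d) where
  toFun x := (fullConditional π m (dropBlock m x)).map (fun y => replaceBlock m y x)
  measurable' := by
    refine Measure.measurable_of_measurable_coe _ fun s hs => ?_
    have hy : ∀ x : BlockSpace d, Measurable (fun y => replaceBlock m y x) := fun x =>
      (measurable_replaceBlock (d := d) m).comp measurable_prodMk_left
    simp only [Measure.map_apply (hy _) hs]
    have : IsMarkovKernel (fullConditional π m) := by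
      unfold fullConditional
      infer_instance
    exact Kernel.measurable_kernel_prodMk_left
      (κ := (fullConditional π m).comap (dropBlock m) (measurable_dropBlock m))
      (measurable_replaceBlock m hs)

/-- The random-scan Gibbs kernel `P^GS = (1/M) ∑ m, P_m`. -/
def gibbsKernel {M : ℕ} {d : Fin M → ℕ} (π : Measure (BlockSpace d)) [IsFiniteMeasure π] :
    Kernel (BlockSpace d) (BlockSpace d) where
  toFun x := (M : ENNReal)⁻¹ • ∑ m, blockUpdateKernel π m x
  measurable' := by
    refine Measure.measurable_of_measurable_coe _ fun s hs => ?_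
    simp only [Measure.smul_apply, Measure.coe_finsetSum, Finset.sum_apply, smul_eq_mul]
    exact (Finset.measurable_sum _ fun m _ =>
      (blockUpdateKernel π m).measurable_coe hs).const_mul _

/-- The law `μ⁽ⁿ⁾` after `n` Gibbs steps from `μ⁽⁰⁾ = μ₀`: `μ⁽ⁿ⁺¹⁾ = μ⁽ⁿ⁾ P^GS`. -/
def gibbsLaw {M : ℕ} {d : Fin M → ℕ} (π : Measure (BlockSpace d)) [IsFiniteMeasure π]
    (μ₀ : Measure (BlockSpace d)) : ℕ → Measure (BlockSpace d)
  | 0 => μ₀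
  | n + 1 => (gibbsLaw π μ₀ n).bind (gibbsKernel π)

/-- `f` is `L`-smooth: it is differentiable and `∇f` is `L`-Lipschitz. -/
def IsLSmooth {E : Type*} [NormedAddCommGroup E] [InnerProductSpace ℝ E] [CompleteSpace E]
    (L : ℝ) (f : E → ℝ) : Prop :=
  Differentiable ℝ f ∧ ∀ x y, ‖gradient f x - gradient f y‖ ≤ L * ‖x - y‖

/-- `U` is convex, `L`-smooth and `lam`-convex with `lam > 0`. -/
structure IsConvexSmooth {E : Type*} [NormedAddCommGroup E] [InnerProductSpace ℝ E]
    [CompleteSpace E] (U : E → ℝ) (L lam : ℝ) : Prop where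
  convex : ConvexOn ℝ Set.univ U
  smooth : IsLSmooth L U
  lam_pos : 0 < lam
  strongly_convex : ConvexOn ℝ Set.univ (fun x => U x - lam / 2 * ‖x‖ ^ 2)

/-- `U(x) = U₀(x) + ∑ m, V m (x_m)` with all `V m` convex, `U₀` of class `C¹`, `U₀` `Lb m`-smooth in
its `m`-th block (uniformly in the other blocks), and `U₀` `lamStar`-convex, `lamStar > 0`, for the
norm `‖x‖_L² = ∑ m, Lb m * ‖x_m‖²`. -/
structure IsBlockConvexSmooth {M : ℕ} {d : Fin M → ℕ} (U U₀ : BlockSpace d → ℝ)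
    (V : (m : Fin M) → EuclideanSpace ℝ (Fin (d m)) → ℝ) (Lb : Fin M → ℝ) (lamStar : ℝ) :
    Prop where
  decomp : ∀ x, U x = U₀ x + ∑ m, V m (x m)
  convex_V : ∀ m, ConvexOn ℝ Set.univ (V m)
  contDiff : ContDiff ℝ 1 U₀
  Lb_pos : ∀ m, 0 < Lb m
  block_smooth : ∀ m (xbar : BlockSpace d), IsLSmooth (Lb m) (fun y => U₀ (replaceBlock m y xbar))
  lamStar_pos : 0 < lamStar
  strongly_convex :
    ConvexOn ℝ Set.univ (fun x => U₀ x - lamStar / 2 * ∑ m, Lb m * ‖x m‖ ^ 2)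

/-- The isotropic Gaussian `N(c, L⁻¹ Id)`, as the law of `c + L^{-1/2} Z` with `Z ∼ N(0, Id)`. -/
def isotropicGaussian {M : ℕ} {d : Fin M → ℕ} (c : BlockSpace d) (L : ℝ) :
    Measure (BlockSpace d) :=
  (stdGaussian (BlockSpace d)).map (fun z => c + (Real.sqrt L)⁻¹ • z)

end

noncomputable section

open scoped ENNReal

/-! ### The Prékopa–Leindler inequality on the line -/

/-! One Gibbs step contracts entropy: if `f` is a bounded density with respect to `π`, then Ent(P^GS
f) ≤ (1 - λ*/M) Ent(f). By convexity of the entropy this follows from ∑ Ent(P_m f) ≤ (M - λ*)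
Ent(f), which is proved through optimisation geometry and a Prékopa–Leindler type inequality.

The geometric input is `IsBlockConvexSmooth.sum_le`: for 0 ≤ t ≤ λ* ≤ 1, moving one block of x at a
time to (1-t)x_m + t y_m and summing the values of U over m gives at most (M-t)U(x) + tU(y). This is
the one-step analysis of coordinate descent: descent lemma in each block, strong convexity after
summation.

The integral input is `lintegral_blockSpace_rpow_mul_le_prod`: if H(x)^(M-t) K(y)^t ≤ ∏ F_m at the
same block-interpolated points, then the integrals satisfy the same inequality. It comes from the
one-dimensional Prékopa–Leindler inequality and Hölder, tensorised over coordinates. It is applied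
to F_m = (P_m f) e^{-U}, K = e^{-U} and H = ∏ (P_m f)^(1/(M-t)) e^{-U}. Since P_m f ignores block m,
its hypothesis is exactly the geometric inequality, and the result is ∫ ∏ (P_m f)^(1/(M-t)) dπ ≤ 1.

Testing this subprobability density against f by means of log u ≤ u - 1, and using ∫ f log P_m f dπ
= Ent(P_m f), gives the sum bound for t < 1; then t increases to λ*.

Iteration and Ent(f) ≤ log C settle the warm start. For the Gaussian start, quadratic bounds on U
around its minimizer give a warm start with C = κ^(d/2). -/

/-- The translates A + inf B and sup A + B both lie in C and meet only at sup A + inf B, a null set.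
-/
theorem volume_add_volume_le_of_isCompact {A B C : Set ℝ} (hA : IsCompact A) (hB : IsCompact B)
    (hA' : A.Nonempty) (hB' : B.Nonempty) (hC : ∀ a ∈ A, ∀ b ∈ B, a + b ∈ C) :
    volume A + volume B ≤ volume C := by
  set a := sSup A
  set b := sInf B
  have ha : a ∈ A := hA.sSup_mem hA'
  have hb : b ∈ B := hB.sInf_mem hB'
  have h1 : volume A = volume (((b + ·) '' A) \ {a + b}) := by
    rw [measure_sdiff_null (measure_singleton _)]
    simp
  have h2 : volume B = volume ((a + ·) '' B) := by simp
  have hBm : MeasurableSet ((a + ·) '' B) := (hB.image (by fun_prop)).isClosed.measurableSet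
  rw [h1, h2, ← measure_union _ hBm]
  · refine measure_mono (Set.union_subset ?_ ?_)
    · rintro _ ⟨⟨x, hx, rfl⟩, -⟩
      simpa [add_comm] using hC x hx b hb
    · rintro _ ⟨x, hx, rfl⟩
      exact hC a ha x hx
  · rw [Set.disjoint_left]
    rintro _ ⟨⟨x, hx, rfl⟩, hne⟩ ⟨y, hy, hxy⟩
    have h3 : x ≤ a := le_csSup hA.bddAbove hx
    have h4 : b ≤ y := csInf_le hB.bddBelow hy
    apply hne
    simp only [Set.mem_singleton_iff] at *
    linarith

/-- The one-dimensional Brunn–Minkowski inequality. -/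
theorem volume_add_volume_le {A B C : Set ℝ} (hA : MeasurableSet A) (hB : MeasurableSet B)
    (hA' : A.Nonempty) (hB' : B.Nonempty) (hC : ∀ a ∈ A, ∀ b ∈ B, a + b ∈ C) :
    volume A + volume B ≤ volume C := by
  obtain ⟨a, ha⟩ := hA'
  obtain ⟨b, hb⟩ := hB'
  have key : ∀ K ⊆ A, IsCompact K → ∀ K' ⊆ B, IsCompact K' → volume K + volume K' ≤ volume C := by
    intro K hKA hK K' hKB hK'
    -- Adjoining `a` and `b` keeps the compact sets nonempty, which the compact case requires.
    calc volume K + volume K' ≤ volume (insert a K) + volume (insert b K') := by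
          gcongr <;> exact Set.subset_insert _ _
      _ ≤ volume C := by
          refine volume_add_volume_le_of_isCompact (hK.insert a) (hK'.insert b)
            (Set.insert_nonempty _ _) (Set.insert_nonempty _ _) fun x hx y hy => hC x ?_ y ?_
          · exact Set.insert_subset ha hKA hx
          · exact Set.insert_subset hb hKB hy
  have hsup : ∀ D : Set ℝ, MeasurableSet D →
      volume D = ⨆ K : {K : Set ℝ // K ⊆ D ∧ IsCompact K}, volume K.1 := fun D hD => by
    rw [hD.measure_eq_iSup_isCompact]
    simp only [iSup_subtype, iSup_and]
  rw [hsup A hA, hsup B hB]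
  have : Nonempty {K : Set ℝ // K ⊆ A ∧ IsCompact K} := ⟨⟨∅, Set.empty_subset _, isCompact_empty⟩⟩
  have : Nonempty {K : Set ℝ // K ⊆ B ∧ IsCompact K} := ⟨⟨∅, Set.empty_subset _, isCompact_empty⟩⟩
  exact ENNReal.iSup_add_iSup_le fun i j => key i.1 i.2.1 i.2.2 j.1 j.2.1 j.2.2

theorem lintegral_eq_lintegral_volume_lt_of_le_one {u : ℝ → ℝ≥0∞} (hu : Measurable u)
    (hu1 : ∀ x, u x ≤ 1) :
    ∫⁻ x, u x = ∫⁻ s in Set.Ioo (0 : ℝ) 1, volume {x | ENNReal.ofReal s < u x} := by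
  have hfin : ∀ x, u x ≠ ∞ := fun x => ne_top_of_le_ne_top ENNReal.one_ne_top (hu1 x)
  have h1 : ∫⁻ x, u x = ∫⁻ x, ENNReal.ofReal (u x).toReal := by
    simp_rw [ENNReal.ofReal_toReal (hfin _)]
  rw [h1, lintegral_eq_lintegral_meas_lt _ (Filter.Eventually.of_forall fun _ =>
    ENNReal.toReal_nonneg) hu.ennreal_toReal.aemeasurable]
  have h2 : ∀ s ∈ Set.Ioi (0 : ℝ), volume {x | s < (u x).toReal} =
      volume {x | ENNReal.ofReal s < u x} := by
    intro s hs
    congr 1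
    ext x
    simp only [Set.mem_ofPred_eq]
    rw [ENNReal.ofReal_lt_iff_lt_toReal (le_of_lt hs) (hfin x)]
  rw [setLIntegral_congr_fun measurableSet_Ioi h2]
  have h3 : (Set.Ioi (0 : ℝ)) = Set.Ioo 0 1 ∪ Set.Ici 1 := by
    rw [Set.Ioo_union_Ici_eq_Ioi zero_lt_one]
  rw [h3, lintegral_union measurableSet_Ici]
  · have h4 : ∫⁻ s in Set.Ici (1 : ℝ), volume {x | ENNReal.ofReal s < u x} = 0 := by
      rw [setLIntegral_congr_fun (g := fun _ => 0) measurableSet_Ici]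
      · simp
      · intro s hs
        have : {x | ENNReal.ofReal s < u x} = ∅ := by
          ext x
          simp only [Set.mem_ofPred_eq, Set.mem_empty_iff_false, iff_false, not_lt]
          exact (hu1 x).trans (by simpa using hs)
        simp [this]
    rw [h4, add_zero]
  · rw [Set.disjoint_left]
    intro x hx hx'
    exact absurd hx.2 (not_lt.2 hx')

theorem volume_smul_add_volume_smul_le {A B C : Set ℝ} (hA : MeasurableSet A)
    (hB : MeasurableSet B) (hA' : A.Nonempty) (hB' : B.Nonempty) {t : ℝ} (ht0 : 0 < t)
    (ht1 : t < 1) (hC : ∀ a ∈ A, ∀ b ∈ B, (1 - t) * a + t * b ∈ C) :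
    ENNReal.ofReal (1 - t) * volume A + ENNReal.ofReal t * volume B ≤ volume C := by
  have h1 : 0 < 1 - t := by linarith
  have e1 := Measure.addHaar_smul (volume : Measure ℝ) (1 - t) A
  have e2 := Measure.addHaar_smul (volume : Measure ℝ) t B
  rw [Module.finrank_self, pow_one, abs_of_pos h1] at e1
  rw [Module.finrank_self, pow_one, abs_of_pos ht0] at e2
  rw [← e1, ← e2]
  refine volume_add_volume_le (hA.const_smul₀ _) (hB.const_smul₀ _) hA'.smul_set hB'.smul_set ?_
  rintro _ ⟨a, ha, rfl⟩ _ ⟨b, hb, rfl⟩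
  simpa using hC a ha b hb

/-- With both suprema equal to 1, the superlevel sets of f and g at every level s < 1 are nonempty,
so Brunn–Minkowski applies level by level and the layer-cake formula integrates the result. The
normalisation even yields an arithmetic mean on the left. -/
theorem add_lintegral_le_of_iSup_eq_one {f g h : ℝ → ℝ≥0∞} (hf : Measurable f)
    (hg : Measurable g) (hh : Measurable h) {t : ℝ} (ht0 : 0 < t) (ht1 : t < 1)
    (hfgh : ∀ x y, f x ^ (1 - t) * g y ^ t ≤ h ((1 - t) * x + t * y))
    (hf1 : ⨆ x, f x = 1) (hg1 : ⨆ x, g x = 1) :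
    ENNReal.ofReal (1 - t) * (∫⁻ x, f x) + ENNReal.ofReal t * ∫⁻ x, g x ≤ ∫⁻ x, h x := by
  have h1t : 0 < 1 - t := by linarith
  have hfle : ∀ x, f x ≤ 1 := fun x => hf1 ▸ le_iSup f x
  have hgle : ∀ x, g x ≤ 1 := fun x => hg1 ▸ le_iSup g x
  -- Capping h at 1 makes the layer-cake formula over levels in (0, 1) available for it too.
  set h' : ℝ → ℝ≥0∞ := fun x => min (h x) 1
  have hh' : Measurable h' := hh.min measurable_const
  have hanti : ∀ u : ℝ → ℝ≥0∞, Measurable fun s : ℝ => volume {x | ENNReal.ofReal s < u x} := by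
    intro u
    refine Antitone.measurable fun s s' hs => measure_mono fun x hx => ?_
    exact lt_of_le_of_lt (ENNReal.ofReal_le_ofReal hs) hx
  calc ENNReal.ofReal (1 - t) * (∫⁻ x, f x) + ENNReal.ofReal t * ∫⁻ x, g x
      = ∫⁻ s in Set.Ioo (0 : ℝ) 1, (ENNReal.ofReal (1 - t) * volume {x | ENNReal.ofReal s < f x} +
          ENNReal.ofReal t * volume {x | ENNReal.ofReal s < g x}) := by
        rw [lintegral_eq_lintegral_volume_lt_of_le_one hf hfle,
          lintegral_eq_lintegral_volume_lt_of_le_one hg hgle,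
          lintegral_add_left ((hanti f).const_mul _), lintegral_const_mul _ (hanti f),
          lintegral_const_mul _ (hanti g)]
    _ ≤ ∫⁻ s in Set.Ioo (0 : ℝ) 1, volume {x | ENNReal.ofReal s < h' x} := by
        refine setLIntegral_mono (hanti h') fun s hs => ?_
        have hs1 : ENNReal.ofReal s < 1 := by simpa using hs.2
        refine volume_smul_add_volume_smul_le (measurableSet_lt measurable_const hf)
          (measurableSet_lt measurable_const hg) ?_ ?_ ht0 ht1 ?_
        · exact lt_iSup_iff.1 (hf1 ▸ hs1)
        · exact lt_iSup_iff.1 (hg1 ▸ hs1)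
        · intro a ha b hb
          simp only [Set.mem_ofPred_eq] at *
          refine lt_min (lt_of_lt_of_le ?_ (hfgh a b)) hs1
          calc ENNReal.ofReal s = ENNReal.ofReal s ^ (1 - t) * ENNReal.ofReal s ^ t := by
                rw [← ENNReal.rpow_add _ _ (by simpa using hs.1) ENNReal.ofReal_ne_top]
                simp
            _ < f a ^ (1 - t) * g b ^ t :=
                ENNReal.mul_lt_mul (ENNReal.rpow_lt_rpow ha h1t) (ENNReal.rpow_lt_rpow hb ht0)
    _ = ∫⁻ x, h' x := (lintegral_eq_lintegral_volume_lt_of_le_one hh' fun x => min_le_right _ _).symm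
    _ ≤ ∫⁻ x, h x := lintegral_mono fun x => min_le_left _ _

theorem ENNReal.rpow_mul_rpow_le_add (a b : ℝ≥0∞) {t : ℝ} (ht0 : 0 < t) (ht1 : t < 1) :
    a ^ (1 - t) * b ^ t ≤ ENNReal.ofReal (1 - t) * a + ENNReal.ofReal t * b := by
  have h1t : 0 < 1 - t := by linarith
  by_cases ha : a = ∞
  · have : ENNReal.ofReal (1 - t) ≠ 0 := by simpa using ht1
    simp [ha, ENNReal.mul_top this]
  by_cases hb : b = ∞
  · have : ENNReal.ofReal t ≠ 0 := by simpa using ht0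
    simp [hb, ENNReal.mul_top this]
  lift a to NNReal using ha
  lift b to NNReal using hb
  have h := NNReal.geom_mean_le_arith_mean2_weighted (1 - t).toNNReal t.toNNReal a b
    (by rw [← Real.toNNReal_add h1t.le ht0.le]; simp)
  rw [Real.coe_toNNReal _ h1t.le, Real.coe_toNNReal _ ht0.le] at h
  rw [← ENNReal.coe_rpow_of_nonneg _ h1t.le, ← ENNReal.coe_rpow_of_nonneg _ ht0.le]
  simp only [ENNReal.ofReal]
  exact_mod_cast h

/-- Both sides are homogeneous, so f and g can be divided by their suprema a and b, and h by a^(1-t)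
b^t; AM–GM then turns the arithmetic mean of the normalised case into the geometric one. -/
theorem prekopaLeindler_of_iSup_ne_top {f g h : ℝ → ℝ≥0∞} (hf : Measurable f)
    (hg : Measurable g) (hh : Measurable h) {t : ℝ} (ht0 : 0 < t) (ht1 : t < 1)
    (hfgh : ∀ x y, f x ^ (1 - t) * g y ^ t ≤ h ((1 - t) * x + t * y))
    (hf1 : ⨆ x, f x ≠ ∞) (hg1 : ⨆ x, g x ≠ ∞) :
    (∫⁻ x, f x) ^ (1 - t) * (∫⁻ x, g x) ^ t ≤ ∫⁻ x, h x := by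
  have h1t : 0 < 1 - t := by linarith
  set a := ⨆ x, f x with ha
  set b := ⨆ x, g x with hb
  by_cases ha0 : a = 0
  · have : ∀ x, f x = 0 := fun x => le_antisymm (ha0 ▸ le_iSup f x) bot_le
    simp [this, h1t]
  by_cases hb0 : b = 0
  · have : ∀ x, g x = 0 := fun x => le_antisymm (hb0 ▸ le_iSup g x) bot_le
    simp [this, ht0]
  set c := a ^ (1 - t) * b ^ t with hc
  have hc0 : c ≠ 0 := mul_ne_zero (by simp [ha0, hf1, ENNReal.rpow_eq_zero_iff])
    (by simp [hb0, hg1, ENNReal.rpow_eq_zero_iff])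
  have hct : c ≠ ∞ := ENNReal.mul_ne_top (ENNReal.rpow_ne_top_of_nonneg h1t.le hf1)
    (ENNReal.rpow_ne_top_of_nonneg ht0.le hg1)
  have hsplit : ∀ u v : ℝ≥0∞, (a⁻¹ * u) ^ (1 - t) * (b⁻¹ * v) ^ t =
      c⁻¹ * (u ^ (1 - t) * v ^ t) := by
    intro u v
    rw [ENNReal.mul_rpow_of_nonneg _ _ h1t.le, ENNReal.mul_rpow_of_nonneg _ _ ht0.le, hc,
      ENNReal.mul_inv (Or.inr (ENNReal.rpow_ne_top_of_nonneg ht0.le hg1))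
        (Or.inl (ENNReal.rpow_ne_top_of_nonneg h1t.le hf1)),
      ENNReal.inv_rpow, ENNReal.inv_rpow]
    ring
  have key := add_lintegral_le_of_iSup_eq_one (hf.const_mul a⁻¹) (hg.const_mul b⁻¹)
    (hh.const_mul c⁻¹) ht0 ht1
    (fun x y => by
      rw [hsplit]
      gcongr
      exact hfgh x y)
    (by rw [← ENNReal.mul_iSup, ENNReal.inv_mul_cancel ha0 hf1])
    (by rw [← ENNReal.mul_iSup, ENNReal.inv_mul_cancel hb0 hg1])
  have := (ENNReal.rpow_mul_rpow_le_add _ _ ht0 ht1).trans key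
  rw [lintegral_const_mul _ hf, lintegral_const_mul _ hg, lintegral_const_mul _ hh, hsplit] at this
  exact (ENNReal.mul_le_mul_iff_right (ENNReal.inv_ne_zero.2 hct) (ENNReal.inv_ne_top.2 hc0)).1 this

/-- The Prékopa–Leindler inequality on the line. -/
theorem prekopaLeindler {f g h : ℝ → ℝ≥0∞} (hf : Measurable f)
    (hg : Measurable g) (hh : Measurable h) {t : ℝ} (ht0 : 0 < t) (ht1 : t < 1)
    (hfgh : ∀ x y, f x ^ (1 - t) * g y ^ t ≤ h ((1 - t) * x + t * y)) :
    (∫⁻ x, f x) ^ (1 - t) * (∫⁻ x, g x) ^ t ≤ ∫⁻ x, h x := by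
  have h1t : 0 < 1 - t := by linarith
  by_cases hf0 : ∫⁻ x, f x = 0
  · simp [hf0, h1t]
  by_cases hg0 : ∫⁻ x, g x = 0
  · simp [hg0, ht0]
  have hlim : ∀ u : ℝ → ℝ≥0∞, Measurable u → Filter.Tendsto (fun n : ℕ => ∫⁻ x, min (u x) n)
      Filter.atTop (nhds (∫⁻ x, u x)) := by
    intro u hu
    refine lintegral_tendsto_of_tendsto_of_monotone
      (fun n => (hu.min measurable_const).aemeasurable)
      (Filter.Eventually.of_forall fun x n m hnm => ?_) (Filter.Eventually.of_forall fun x => ?_)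
    · exact min_le_min_left _ (by exact_mod_cast hnm)
    · have := (tendsto_const_nhds (x := u x)).min ENNReal.tendsto_nat_nhds_top
      simpa using this
  have htrunc : ∀ n : ℕ, (∫⁻ x, min (f x) n) ^ (1 - t) * (∫⁻ x, min (g x) n) ^ t ≤ ∫⁻ x, h x := by
    intro n
    refine prekopaLeindler_of_iSup_ne_top (hf.min measurable_const) (hg.min measurable_const) hh
      ht0 ht1 (fun x y => le_trans ?_ (hfgh x y)) ?_ ?_
    · gcongr <;> exact min_le_left _ _
    · exact ne_top_of_le_ne_top (ENNReal.natCast_ne_top n) (iSup_le fun x => min_le_right _ _)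
    · exact ne_top_of_le_ne_top (ENNReal.natCast_ne_top n) (iSup_le fun x => min_le_right _ _)
  -- Multiplication is discontinuous at (0, ∞), so the limit uses that neither integral vanishes.
  refine le_of_tendsto' (ENNReal.Tendsto.mul ((hlim f hf).ennrpow_const (1 - t)) ?_
    ((hlim g hg).ennrpow_const t) ?_) htrunc
  · left; simp [ENNReal.rpow_eq_zero_iff, hf0, ht1.le]
  · left; simp [ENNReal.rpow_eq_zero_iff, hg0, ht0.le]

/-! ### A Prékopa–Leindler inequality for functions interpolated in one block at a time -/

/-- The step for a single real coordinate, which belongs to block `i₀`. Let P be the product of the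
other F_i and A = (H^s / P)^(1/(1-t)). Then A, K and F_{i₀} satisfy the Prékopa–Leindler hypothesis,
while H is at most A^((1-t)/s) P^(1/s), so Hölder bounds ∫ H by the integrals of A and of the
remaining F_i. -/
theorem lintegral_rpow_mul_le_prod {ι : Type*} [Fintype ι] [DecidableEq ι]
    {F : ι → ℝ → ℝ≥0∞} {H K : ℝ → ℝ≥0∞} (hF : ∀ i, Measurable (F i)) (hH : Measurable H)
    (hK : Measurable K) {s t : ℝ} (ht0 : 0 < t) (ht1 : t < 1) (hs : s = Fintype.card ι - t)
    (i₀ : ι)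
    (hHK : ∀ x y, H x ^ s * K y ^ t ≤ ∏ i, F i (if i = i₀ then (1 - t) * x + t * y else x)) :
    (∫⁻ x, H x) ^ s * (∫⁻ x, K x) ^ t ≤ ∏ i, ∫⁻ x, F i x := by
  have h1t : 0 < 1 - t := by linarith
  have hcard : (1 : ℝ) ≤ Fintype.card ι := by
    exact_mod_cast Fintype.card_pos_iff.2 ⟨i₀⟩
  have hs0 : 0 < s := by linarith
  by_cases hH0 : ∫⁻ x, H x = 0
  · simp [hH0, hs0]
  by_cases hK0 : ∫⁻ x, K x = 0
  · simp [hK0, ht0]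
  set P : ℝ → ℝ≥0∞ := fun x => ∏ i ∈ Finset.univ.erase i₀, F i x with hP
  have hPm : Measurable P := Finset.measurable_prod _ fun i _ => hF i
  have hHK' : ∀ x y, H x ^ s * K y ^ t ≤ F i₀ ((1 - t) * x + t * y) * P x := by
    intro x y
    refine (hHK x y).trans (le_of_eq ?_)
    rw [← Finset.mul_prod_erase _ _ (Finset.mem_univ i₀)]
    simp only [if_true, hP]
    congr 1
    exact Finset.prod_congr rfl fun i hi => by rw [if_neg (Finset.ne_of_mem_erase hi)]
  obtain ⟨y₀, hy₀⟩ : ∃ y, K y ≠ 0 := by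
    by_contra! h
    exact hK0 (by simp [h])
  have hP0 : ∀ x, P x = 0 → H x = 0 := by
    intro x hx
    have := hHK' x y₀
    rw [hx, mul_zero, le_zero_iff, mul_eq_zero] at this
    rcases this with h | h
    · simpa [ENNReal.rpow_eq_zero_iff, hs0, hs0.le, not_lt.2 hs0.le] using h
    · simp [ENNReal.rpow_eq_zero_iff, not_lt.2 ht0.le, hy₀] at h
  -- Excludes a product 0 · ∞ on the right. For i ≠ i₀, H vanishes wherever F_i does; for i₀,
  -- Prékopa–Leindler for the indicators of the supports would force H or K to vanish almost
  -- everywhere.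
  have hne : ∀ i, ∫⁻ x, F i x ≠ 0 := by
    intro i h0
    rw [lintegral_eq_zero_iff (hF i)] at h0
    by_cases hi : i = i₀
    · subst hi
      have hind : ∀ {u : ℝ → ℝ≥0∞}, Measurable u → MeasurableSet {x | u x ≠ 0} := fun hu =>
        (hu (measurableSet_singleton 0)).compl
      have := prekopaLeindler (f := {x | H x ≠ 0}.indicator 1) (g := {x | K x ≠ 0}.indicator 1)
        (h := {x | F i x ≠ 0}.indicator 1) (measurable_one.indicator (hind hH))
        (measurable_one.indicator (hind hK)) (measurable_one.indicator (hind (hF i))) ht0 ht1 ?_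
      · rw [lintegral_indicator_one (hind hH), lintegral_indicator_one (hind hK),
          lintegral_indicator_one (hind (hF i)), show volume {x | F i x ≠ 0} = 0 from h0,
          le_zero_iff, mul_eq_zero, ENNReal.rpow_eq_zero_iff, ENNReal.rpow_eq_zero_iff] at this
        rcases this with h | h
        · refine hH0 ((lintegral_eq_zero_iff hH).2 ?_)
          rcases h with h | h
          · exact h.1
          · linarith [h.2]
        · refine hK0 ((lintegral_eq_zero_iff hK).2 ?_)
          rcases h with h | h
          · exact h.1
          · linarith [h.2]
      · intro x y
        by_cases hx : H x = 0
        · simp [hx, h1t]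
        by_cases hy : K y = 0
        · simp [hy, ht0]
        have h3 : F i ((1 - t) * x + t * y) ≠ 0 := by
          intro h
          have := hHK' x y
          rw [h, zero_mul, le_zero_iff, mul_eq_zero] at this
          rcases this with h | h
          · simp [ENNReal.rpow_eq_zero_iff, not_lt.2 hs0.le, hx] at h
          · simp [ENNReal.rpow_eq_zero_iff, not_lt.2 ht0.le, hy] at h
        simp [hx, hy, h3]
    · refine hH0 ((lintegral_eq_zero_iff hH).2 ?_)
      filter_upwards [h0] with x hx
      exact hP0 x (Finset.prod_eq_zero (Finset.mem_erase.2 ⟨hi, Finset.mem_univ i⟩) hx)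
  by_cases htop : ∃ i, ∫⁻ x, F i x = ∞
  · obtain ⟨i, hi⟩ := htop
    rw [← Finset.mul_prod_erase _ _ (Finset.mem_univ i), hi,
      ENNReal.top_mul (Finset.prod_ne_zero_iff.2 fun j _ => hne j)]
    exact le_top
  push Not at htop
  have hPtop : ∀ᵐ x, P x ≠ ∞ := by
    have : ∀ᵐ x, ∀ i, F i x < ∞ := ae_all_iff.2 fun i => ae_lt_top (hF i) (htop i)
    filter_upwards [this] with x hx
    exact ENNReal.prod_ne_top fun i _ => (hx i).ne
  set A : ℝ → ℝ≥0∞ := fun x => (H x ^ s / P x) ^ (1 / (1 - t)) with hA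
  have hAm : Measurable A := ((hH.pow_const s).div hPm).pow_const _
  have hApow : ∀ x, A x ^ (1 - t) = H x ^ s / P x := fun x => by
    simp only [hA]
    rw [← ENNReal.rpow_mul, one_div, inv_mul_cancel₀ h1t.ne', ENNReal.rpow_one]
  have hPL := prekopaLeindler hAm hK (hF i₀) ht0 ht1 fun x y => by
    rw [hApow]
    by_cases hx : P x = 0
    · simp [hP0 x hx, hs0]
    rw [← ENNReal.mul_div_right_comm]
    exact ENNReal.div_le_of_le_mul (hHK' x y)
  have hHold : (∫⁻ x, H x) ^ s ≤ (∫⁻ x, A x) ^ (1 - t) * ∏ i ∈ Finset.univ.erase i₀, ∫⁻ x, F i x := by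
    have hle : ∫⁻ x, H x ≤ ∫⁻ x, ∏ i, (Function.update F i₀ A i x) ^
        (Function.update (fun _ => 1 / s) i₀ ((1 - t) / s) i) := by
      refine lintegral_mono_ae ?_
      filter_upwards [hPtop] with x hx
      rw [← Finset.mul_prod_erase _ _ (Finset.mem_univ i₀)]
      have : ∏ i ∈ Finset.univ.erase i₀, (Function.update F i₀ A i x) ^
          (Function.update (fun _ => 1 / s) i₀ ((1 - t) / s) i) = P x ^ (1 / s) := by
        rw [hP, ← ENNReal.prod_rpow_of_nonneg (by positivity)]
        exact Finset.prod_congr rfl fun i hi => by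
          rw [Function.update_of_ne (Finset.ne_of_mem_erase hi),
            Function.update_of_ne (Finset.ne_of_mem_erase hi)]
      rw [this]
      simp only [Function.update_self]
      rw [div_eq_mul_one_div (1 - t) s, ENNReal.rpow_mul, hApow,
        ← ENNReal.mul_rpow_of_nonneg _ _ (by positivity)]
      rw [ENNReal.div_mul_cancel' (fun h => by simp [hP0 x h, hs0]) (fun h => absurd h hx),
        ← ENNReal.rpow_mul, mul_one_div_cancel hs0.ne', ENNReal.rpow_one]
    -- The Hölder exponents: (1-t) + (card ι - 1) = s.
    have hsum : ∑ i, (Function.update (fun _ : ι => 1 / s) i₀ ((1 - t) / s) i) = 1 := by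
      rw [Finset.sum_update_of_mem (Finset.mem_univ _)]
      have : ((Finset.univ \ {i₀}).card : ℝ) = Fintype.card ι - 1 := by
        rw [Finset.sdiff_singleton_eq_erase, Finset.card_erase_of_mem (Finset.mem_univ _),
          Finset.card_univ, Nat.cast_sub (by exact_mod_cast hcard), Nat.cast_one]
      rw [Finset.sum_const, nsmul_eq_mul, this]
      field_simp
      linarith
    have := hle.trans (ENNReal.lintegral_prod_norm_pow_le Finset.univ
      (f := Function.update F i₀ A) (fun i _ => ?_) hsum (fun i _ => ?_))
    · rw [← Finset.mul_prod_erase _ _ (Finset.mem_univ i₀)] at this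
      have h2 : ∏ i ∈ Finset.univ.erase i₀, (∫⁻ x, Function.update F i₀ A i x) ^
          (Function.update (fun _ => 1 / s) i₀ ((1 - t) / s) i) =
          (∏ i ∈ Finset.univ.erase i₀, ∫⁻ x, F i x) ^ (1 / s) := by
        rw [← ENNReal.prod_rpow_of_nonneg (by positivity)]
        exact Finset.prod_congr rfl fun i hi => by
          rw [Function.update_of_ne (Finset.ne_of_mem_erase hi),
            Function.update_of_ne (Finset.ne_of_mem_erase hi)]
      rw [h2] at this
      simp only [Function.update_self] at this
      rw [div_eq_mul_one_div (1 - t) s, ENNReal.rpow_mul,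
        ← ENNReal.mul_rpow_of_nonneg _ _ (by positivity)] at this
      have h3 := ENNReal.rpow_le_rpow this hs0.le
      rwa [← ENNReal.rpow_mul, one_div_mul_cancel hs0.ne', ENNReal.rpow_one] at h3
    · by_cases hi : i = i₀
      · subst hi; simpa using hAm.aemeasurable
      · simpa [hi] using (hF i).aemeasurable
    · by_cases hi : i = i₀
      · subst hi; simp only [Function.update_self]; positivity
      · simp only [Function.update_of_ne hi]; positivity
  calc (∫⁻ x, H x) ^ s * (∫⁻ x, K x) ^ t
      ≤ ((∫⁻ x, A x) ^ (1 - t) * ∏ i ∈ Finset.univ.erase i₀, ∫⁻ x, F i x) *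
          (∫⁻ x, K x) ^ t := by gcongr
    _ = ((∫⁻ x, A x) ^ (1 - t) * (∫⁻ x, K x) ^ t) *
          ∏ i ∈ Finset.univ.erase i₀, ∫⁻ x, F i x := by ring
    _ ≤ (∫⁻ x, F i₀ x) * ∏ i ∈ Finset.univ.erase i₀, ∫⁻ x, F i x := by gcongr
    _ = ∏ i, ∫⁻ x, F i x :=
        Finset.mul_prod_erase _ (fun i => ∫⁻ x, F i x) (Finset.mem_univ i₀)

/-- Tensorisation: the inequality keeps its form when one more coordinate is integrated out, so the
one-coordinate step can be iterated. The map `b` records the block of each coordinate, and only the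
factor of that block sees an interpolated value. -/
theorem lmarginal_rpow_mul_le_prod {σ ι : Type*} [DecidableEq σ] [Fintype ι]
    [DecidableEq ι] (b : σ → ι) {F : ι → (σ → ℝ) → ℝ≥0∞} {H K : (σ → ℝ) → ℝ≥0∞}
    (hF : ∀ i, Measurable (F i)) (hH : Measurable H) (hK : Measurable K) {s t : ℝ} (ht0 : 0 < t)
    (ht1 : t < 1) (hs : s = Fintype.card ι - t)
    (hHK : ∀ x y, H x ^ s * K y ^ t ≤
      ∏ i, F i (fun k => if i = b k then (1 - t) * x k + t * y k else x k))
    (S : Finset σ) (x y : σ → ℝ) :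
    (∫⋯∫⁻_S, H ∂fun _ => volume) x ^ s * (∫⋯∫⁻_S, K ∂fun _ => volume) y ^ t ≤
      ∏ i, (∫⋯∫⁻_S, F i ∂fun _ => volume)
        (fun k => if i = b k then (1 - t) * x k + t * y k else x k) := by
  induction S using Finset.induction_on generalizing x y with
  | empty => simpa using hHK x y
  | insert k S hk ih =>
    simp_rw [lmarginal_insert _ hH hk, lmarginal_insert _ hK hk, lmarginal_insert _ (hF _) hk]
    refine lintegral_rpow_mul_le_prod (fun i => ?_) ?_ ?_ ht0 ht1 hs (b k) fun u v => ?_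
    · exact ((hF i).lmarginal _).comp (measurable_update _)
    · exact (hH.lmarginal _).comp (measurable_update _)
    · exact (hK.lmarginal _).comp (measurable_update _)
    · refine (ih (Function.update x k u) (Function.update y k v)).trans (le_of_eq ?_)
      refine Finset.prod_congr rfl fun i _ => ?_
      congr 1
      ext l
      by_cases hl : l = k
      · subst hl; simp
      · simp [hl]

theorem lintegral_pi_rpow_mul_le_prod {σ ι : Type*} [Fintype σ] [Fintype ι]
    [DecidableEq ι] (b : σ → ι) {F : ι → (σ → ℝ) → ℝ≥0∞} {H K : (σ → ℝ) → ℝ≥0∞}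
    (hF : ∀ i, Measurable (F i)) (hH : Measurable H) (hK : Measurable K) {s t : ℝ} (ht0 : 0 < t)
    (ht1 : t < 1) (hs : s = Fintype.card ι - t)
    (hHK : ∀ x y, H x ^ s * K y ^ t ≤
      ∏ i, F i (fun k => if i = b k then (1 - t) * x k + t * y k else x k)) :
    (∫⁻ x, H x) ^ s * (∫⁻ x, K x) ^ t ≤ ∏ i, ∫⁻ x, F i x := by
  classical
  simpa [volume_pi] using lmarginal_rpow_mul_le_prod b hF hH hK ht0 ht1 hs hHK Finset.univ 0 0

theorem lintegral_blockSpace_rpow_mul_le_prod {M : ℕ} {d : Fin M → ℕ}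
    {F : Fin M → BlockSpace d → ℝ≥0∞} {H K : BlockSpace d → ℝ≥0∞}
    (hF : ∀ m, Measurable (F m)) (hH : Measurable H) (hK : Measurable K) {t : ℝ} (ht0 : 0 < t)
    (ht1 : t < 1)
    (hHK : ∀ x y, H x ^ ((M : ℝ) - t) * K y ^ t ≤
      ∏ m, F m (replaceBlock m ((1 - t) • x m + t • y m) x)) :
    (∫⁻ x, H x) ^ ((M : ℝ) - t) * (∫⁻ x, K x) ^ t ≤ ∏ m, ∫⁻ x, F m x := by
  set e : EuclideanSpace ℝ ((m : Fin M) × Fin (d m)) ≃ₗᵢ[ℝ] BlockSpace d :=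
    LinearIsometryEquiv.piLpCurry ℝ 2 (fun (m : Fin M) (_ : Fin (d m)) => ℝ) with he
  set φ : ((m : Fin M) × Fin (d m) → ℝ) → BlockSpace d := fun x => e (WithLp.toLp 2 x) with hφ
  have hmp : MeasurePreserving φ volume volume :=
    e.measurePreserving.comp (PiLp.volume_preserving_toLp _)
  have hφa : ∀ x m k, φ x m k = x ⟨m, k⟩ := fun x m k => by
    simp [hφ, he, Sigma.curry]
  rw [← hmp.lintegral_comp hH, ← hmp.lintegral_comp hK]
  simp_rw [← hmp.lintegral_comp (hF _)]
  refine lintegral_pi_rpow_mul_le_prod (fun k => k.1) (fun m => (hF m).comp hmp.measurable)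
    (hH.comp hmp.measurable) (hK.comp hmp.measurable) ht0 ht1 (by simp) fun x y => ?_
  refine (hHK (φ x) (φ y)).trans (le_of_eq ?_)
  refine Finset.prod_congr rfl fun m _ => ?_
  congr 1
  ext i k
  simp only [replaceBlock, hφa]
  by_cases hi : i = m
  · subst hi
    simp [hφa]
  · simp [hi, hφa, Ne.symm hi]

/-! ### Smooth and strongly convex functions -/

section Convex

variable {E : Type*} [NormedAddCommGroup E] [InnerProductSpace ℝ E] [CompleteSpace E]

omit [CompleteSpace E] in
theorem hasDerivAt_comp_add_smul {f : E → ℝ} (hf : Differentiable ℝ f) (x v : E) (s : ℝ) :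
    HasDerivAt (fun s : ℝ => f (x + s • v)) (fderiv ℝ f (x + s • v) v) s := by
  have h1 : HasDerivAt (fun s : ℝ => x + s • v) v s := by
    simpa using ((hasDerivAt_id s).smul_const v).const_add x
  exact (hf (x + s • v)).hasFDerivAt.comp_hasDerivAt s h1

/-- The descent lemma. -/
theorem IsLSmooth.le_add {f : E → ℝ} {L : ℝ} (hf : IsLSmooth L f) (x v : E) :
    f (x + v) ≤ f x + fderiv ℝ f x v + L / 2 * ‖v‖ ^ 2 := by
  have hder : ∀ s : ℝ, 0 ≤ s → fderiv ℝ f (x + s • v) v ≤ fderiv ℝ f x v + L * ‖v‖ ^ 2 * s := by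
    intro s hs
    have hg : ∀ z, fderiv ℝ f z v = inner ℝ (gradient f z) v := fun z => by
      rw [gradient, InnerProductSpace.toDual_symm_apply]
    rw [hg, hg, ← sub_le_iff_le_add', ← inner_sub_left]
    calc inner ℝ (gradient f (x + s • v) - gradient f x) v
        ≤ ‖gradient f (x + s • v) - gradient f x‖ * ‖v‖ := real_inner_le_norm _ _
      _ ≤ (L * ‖x + s • v - x‖) * ‖v‖ := by gcongr; exact hf.2 _ _
      _ = L * ‖v‖ ^ 2 * s := by
          rw [add_sub_cancel_left, norm_smul, Real.norm_of_nonneg hs]; ring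
  have := image_le_of_deriv_right_le_deriv_boundary (a := 0) (b := 1)
    (f := fun s : ℝ => f (x + s • v)) (f' := fun s => fderiv ℝ f (x + s • v) v)
    (B := fun s => f x + (fderiv ℝ f x v) * s + L * ‖v‖ ^ 2 * (s ^ 2 / 2))
    (B' := fun s => fderiv ℝ f x v + L * ‖v‖ ^ 2 * s)
    (fun s _ => (hasDerivAt_comp_add_smul hf.1 x v s).continuousAt.continuousWithinAt)
    (fun s _ => (hasDerivAt_comp_add_smul hf.1 x v s).hasDerivWithinAt)
    (by simp) (by fun_prop)
    (fun s _ => by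
      have h1 : HasDerivAt (fun s : ℝ => s ^ 2 / 2) s s := by
        simpa using ((hasDerivAt_id s).pow 2).div_const 2
      have h2 : HasDerivAt (fun s : ℝ => (fderiv ℝ f x v) * s) (fderiv ℝ f x v) s := by
        simpa using (hasDerivAt_id s).const_mul (fderiv ℝ f x v)
      exact ((h2.const_add (f x)).add (h1.const_mul (L * ‖v‖ ^ 2))).hasDerivWithinAt)
    (fun s hs => hder s hs.1) (Set.right_mem_Icc.2 zero_le_one)
  simp only [one_smul, mul_one] at this
  linarith

omit [CompleteSpace E] in
/-- A differentiable function which is convex after subtraction of a quadratic form `Q` lies above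
its tangents by at least `Q`. -/
theorem ConvexOn.add_fderiv_add_le {f Q : E → ℝ} {x : E} (hf : Differentiable ℝ f)
    (hQ : ∀ x v (s : ℝ), Q (x + s • v) = (1 - s) * Q x + s * Q (x + v) - s * (1 - s) * Q v)
    (h : ConvexOn ℝ Set.univ fun x => f x - Q x) (v : E) :
    f x + fderiv ℝ f x v + Q v ≤ f (x + v) := by
  have h0 := hasDerivAt_comp_add_smul hf x v 0
  rw [zero_smul, add_zero] at h0
  have h1 := h0.tendsto_slope_zero_right
  have h2 : Filter.Tendsto (fun s : ℝ => f (x + v) - f x - (1 - s) * Q v)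
      (nhdsWithin 0 (Set.Ioi 0)) (nhds (f (x + v) - f x - (1 - 0) * Q v)) :=
    (Continuous.tendsto (by fun_prop) _).mono_left nhdsWithin_le_nhds
  have h3 := le_of_tendsto_of_tendsto h1 h2 ?_
  · linarith
  · have : Set.Ioo (0 : ℝ) 1 ∈ nhdsWithin (0 : ℝ) (Set.Ioi 0) := Ioo_mem_nhdsGT zero_lt_one
    filter_upwards [this] with s hs
    have h4 := h.2 (Set.mem_univ x) (Set.mem_univ (x + v)) (sub_nonneg.2 hs.2.le) hs.1.le
      (by ring)
    have h5 : (1 - s) • x + s • (x + v) = x + s • v := by module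
    rw [h5] at h4
    simp only [smul_eq_mul, hQ] at h4 ⊢
    rw [zero_add, zero_smul, add_zero, inv_mul_le_iff₀ hs.1]
    linarith

omit [CompleteSpace E] in
-- The quadratic identity that `ConvexOn.add_fderiv_add_le` demands of Q.
theorem norm_sq_add_smul (c : ℝ) (x v : E) (s : ℝ) :
    c / 2 * ‖x + s • v‖ ^ 2 = (1 - s) * (c / 2 * ‖x‖ ^ 2) + s * (c / 2 * ‖x + v‖ ^ 2) -
      s * (1 - s) * (c / 2 * ‖v‖ ^ 2) := by
  rw [norm_add_sq_real, norm_add_sq_real, norm_smul, inner_smul_right, mul_pow,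
    Real.norm_eq_abs, sq_abs]
  ring

theorem IsLSmooth.le_of_convexOn_sub [Nontrivial E] {f : E → ℝ} {L c : ℝ} (hf : IsLSmooth L f)
    (h : ConvexOn ℝ Set.univ fun x => f x - c / 2 * ‖x‖ ^ 2) : c ≤ L := by
  obtain ⟨v, hv⟩ := exists_ne (0 : E)
  have h1 := hf.le_add 0 v
  have h2 := h.add_fderiv_add_le (x := 0) hf.1 (norm_sq_add_smul c) v
  have h3 : 0 < ‖v‖ ^ 2 := by positivity
  have h4 : c / 2 * ‖v‖ ^ 2 ≤ L / 2 * ‖v‖ ^ 2 := by linarith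
  linarith [le_of_mul_le_mul_right h4 h3]

theorem norm_gradient_sub_gradient {F : Type*} [NormedAddCommGroup F] [InnerProductSpace ℝ F]
    [CompleteSpace F] (f : F → ℝ) (x y : F) :
    ‖gradient f x - gradient f y‖ = ‖fderiv ℝ f x - fderiv ℝ f y‖ := by
  rw [gradient, gradient, ← map_sub, LinearIsometryEquiv.norm_map]

theorem IsLSmooth.contDiff {f : E → ℝ} {L : ℝ} (hf : IsLSmooth L f) : ContDiff ℝ 1 f := by
  rw [contDiff_one_iff_fderiv]
  refine ⟨hf.1, ?_⟩
  have h1 : Continuous (gradient f) := by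
    refine (LipschitzWith.of_dist_le' (K := L) fun x y => ?_).continuous
    rw [dist_eq_norm, dist_eq_norm]
    exact hf.2 x y
  have h2 : fderiv ℝ f = fun x => InnerProductSpace.toDual ℝ E (gradient f x) := by
    ext x
    simp [gradient]
  rw [h2]
  exact (InnerProductSpace.toDual ℝ E).continuous.comp h1

variable {U : E → ℝ} {L lam : ℝ}

theorem IsConvexSmooth.lam_le [Nontrivial E] (h : IsConvexSmooth U L lam) : lam ≤ L :=
  h.smooth.le_of_convexOn_sub h.strongly_convex

theorem IsConvexSmooth.add_le_of_forall_le (h : IsConvexSmooth U L lam) {x : E}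
    (hx : ∀ y, U x ≤ U y) (y : E) : U x + lam / 2 * ‖y - x‖ ^ 2 ≤ U y := by
  have h0 : fderiv ℝ U x = 0 := IsLocalMin.fderiv_eq_zero (Filter.Eventually.of_forall hx)
  have := h.strongly_convex.add_fderiv_add_le (x := x) h.smooth.1 (norm_sq_add_smul lam) (y - x)
  simpa [h0] using this

theorem IsConvexSmooth.le_add_of_forall_le (h : IsConvexSmooth U L lam) {x : E}
    (hx : ∀ y, U x ≤ U y) (y : E) : U y ≤ U x + L / 2 * ‖y - x‖ ^ 2 := by
  have h0 : fderiv ℝ U x = 0 := IsLocalMin.fderiv_eq_zero (Filter.Eventually.of_forall hx)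
  simpa [h0] using h.smooth.le_add x (y - x)

theorem IsConvexSmooth.existsUnique_forall_le [FiniteDimensional ℝ E]
    (h : IsConvexSmooth U L lam) : ∃! x, ∀ y, U x ≤ U y := by
  have hlim : Filter.Tendsto U (Filter.cocompact E) Filter.atTop := by
    -- With r = ‖y‖ this is a lower bound for U(y), from strong convexity at 0; it makes U coercive.
    have h1 : Filter.Tendsto (fun r : ℝ => U 0 + r * (lam / 2 * r - ‖fderiv ℝ U 0‖)) Filter.atTop
        Filter.atTop := by
      refine Filter.tendsto_atTop_add_const_left _ _ (Filter.tendsto_id.atTop_mul_atTop₀ ?_)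
      exact Filter.tendsto_atTop_add_const_right _ _
        (Filter.tendsto_id.const_mul_atTop (half_pos h.lam_pos))
    refine Filter.tendsto_atTop_mono (fun y => ?_) (h1.comp (tendsto_norm_cocompact_atTop (E := E)))
    have h2 := h.strongly_convex.add_fderiv_add_le (x := 0) h.smooth.1 (norm_sq_add_smul lam) y
    have h3 := (abs_le.1 ((fderiv ℝ U 0).le_opNorm y)).1
    rw [zero_add] at h2
    simp only [Function.comp_apply]
    nlinarith
  obtain ⟨x, hx⟩ := h.smooth.1.continuous.exists_forall_le hlim
  refine ⟨x, hx, fun z hz => ?_⟩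
  have h1 := h.add_le_of_forall_le hx z
  have h2 := hz x
  have h3 : ‖z - x‖ ^ 2 ≤ 0 := by nlinarith [h.lam_pos]
  have h4 : ‖z - x‖ = 0 := by nlinarith [norm_nonneg (z - x)]
  exact sub_eq_zero.1 (norm_eq_zero.1 h4)

end Convex

/-! ### Block coordinates -/

section Block

variable {M : ℕ} {d : Fin M → ℕ}

theorem replaceBlock_self (m : Fin M) (y : EuclideanSpace ℝ (Fin (d m))) (x : BlockSpace d) :
    replaceBlock m y x m = y := by
  simp [replaceBlock]

theorem replaceBlock_of_ne {m i : Fin M} (h : i ≠ m) (y : EuclideanSpace ℝ (Fin (d m)))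
    (x : BlockSpace d) : replaceBlock m y x i = x i := by
  simp [replaceBlock, h]

/-- The inclusion of the `m`-th block. -/
def blockInclusion (m : Fin M) : EuclideanSpace ℝ (Fin (d m)) →L[ℝ] BlockSpace d :=
  LinearMap.toContinuousLinearMap
    { toFun := fun v => replaceBlock m v 0
      map_add' := fun v w => by
        ext1 i
        by_cases h : i = m
        · subst h; simp [replaceBlock_self]
        · simp [replaceBlock_of_ne h]
      map_smul' := fun c v => by
        ext1 i
        by_cases h : i = m
        · subst h; simp [replaceBlock_self]
        · simp [replaceBlock_of_ne h] }

theorem blockInclusion_apply (m : Fin M) (v : EuclideanSpace ℝ (Fin (d m))) :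
    blockInclusion m v = replaceBlock m v 0 := rfl

theorem replaceBlock_eq_add (m : Fin M) (y : EuclideanSpace ℝ (Fin (d m))) (x : BlockSpace d) :
    replaceBlock m y x = x + blockInclusion m (y - x m) := by
  ext1 i
  rw [blockInclusion_apply]
  by_cases h : i = m
  · subst h; simp [replaceBlock_self]
  · simp [replaceBlock_of_ne h]

theorem sum_blockInclusion (v : BlockSpace d) : ∑ m, blockInclusion m (v m) = v := by
  ext1 i
  rw [WithLp.ofLp_sum, Finset.sum_apply, Finset.sum_eq_single i]
  · rw [blockInclusion_apply, replaceBlock_self]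
  · intro m _ h
    rw [blockInclusion_apply, replaceBlock_of_ne h.symm]
    rfl
  · simp

theorem norm_blockInclusion_apply (m : Fin M) (v : EuclideanSpace ℝ (Fin (d m))) :
    ‖blockInclusion m v‖ = ‖v‖ := by
  rw [← sq_eq_sq₀ (norm_nonneg _) (norm_nonneg _), PiLp.norm_sq_eq_of_L2,
    Finset.sum_eq_single m, blockInclusion_apply, replaceBlock_self]
  · intro i _ hi
    rw [blockInclusion_apply, replaceBlock_of_ne hi]
    simp
  · simp

theorem hasFDerivAt_comp_replaceBlock {f : BlockSpace d → ℝ} (hf : Differentiable ℝ f) (m : Fin M)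
    (x : BlockSpace d) (y : EuclideanSpace ℝ (Fin (d m))) :
    HasFDerivAt (fun z => f (replaceBlock m z x))
      ((fderiv ℝ f (replaceBlock m y x)).comp (blockInclusion m)) y := by
  have h : HasFDerivAt (fun z => replaceBlock m z x) (blockInclusion m) y := by
    rw [show (fun z => replaceBlock m z x) = fun z => x + blockInclusion m (z - x m) from
      funext fun z => replaceBlock_eq_add m z x]
    exact (((blockInclusion m).hasFDerivAt.comp y
      ((hasFDerivAt_id y).sub_const (x m))).const_add x)
  exact (hf _).hasFDerivAt.comp y h

theorem weighted_norm_sq_add_smul (c : ℝ) (Lb : Fin M → ℝ) (x v : BlockSpace d) (s : ℝ) :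
    c / 2 * ∑ m, Lb m * ‖(x + s • v) m‖ ^ 2 =
      (1 - s) * (c / 2 * ∑ m, Lb m * ‖x m‖ ^ 2) + s * (c / 2 * ∑ m, Lb m * ‖(x + v) m‖ ^ 2) -
      s * (1 - s) * (c / 2 * ∑ m, Lb m * ‖v m‖ ^ 2) := by
  simp only [Finset.mul_sum]
  rw [← Finset.sum_add_distrib, ← Finset.sum_sub_distrib]
  refine Finset.sum_congr rfl fun m _ => ?_
  have := norm_sq_add_smul (c * Lb m) (x m) (v m) s
  simp only [PiLp.add_apply, PiLp.smul_apply]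
  linarith

variable {U U₀ : BlockSpace d → ℝ} {V : (m : Fin M) → EuclideanSpace ℝ (Fin (d m)) → ℝ}
  {Lb : Fin M → ℝ} {lamStar : ℝ}

theorem IsBlockConvexSmooth.continuous (h : IsBlockConvexSmooth U U₀ V Lb lamStar) :
    Continuous U := by
  have hV : ∀ m, Continuous (V m) := fun m =>
    continuousOn_univ.1 ((h.convex_V m).continuousOn isOpen_univ)
  rw [show U = fun x => U₀ x + ∑ m, V m (x m) from funext h.decomp]
  refine h.contDiff.continuous.add (continuous_finsetSum _ fun m _ => (hV m).comp ?_)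
  fun_prop

/-- Along a nontrivial block U₀ is λ*L_m-strongly convex and L_m-smooth, hence λ*L_m ≤ L_m. -/
theorem IsBlockConvexSmooth.lamStar_le_one (h : IsBlockConvexSmooth U U₀ V Lb lamStar)
    (m : Fin M) (hd : 1 ≤ d m) : lamStar ≤ 1 := by
  have : Nonempty (Fin (d m)) := ⟨⟨0, hd⟩⟩
  have hconv : ConvexOn ℝ Set.univ
      fun y => U₀ (replaceBlock m y 0) - (lamStar * Lb m) / 2 * ‖y‖ ^ 2 := by
    have h1 := h.strongly_convex.comp_linearMap (blockInclusion m : _ →L[ℝ] BlockSpace d).toLinearMap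
    rw [Set.preimage_univ] at h1
    refine h1.congr fun y _ => ?_
    simp only [Function.comp_apply, ContinuousLinearMap.coe_coe, blockInclusion_apply]
    rw [Finset.sum_eq_single m]
    · rw [replaceBlock_self]; ring
    · intro i _ hi
      rw [replaceBlock_of_ne hi]; simp
    · simp
  have h2 := (h.block_smooth m 0).le_of_convexOn_sub hconv
  exact le_of_mul_le_mul_right (by linarith) (h.Lb_pos m)

/-- The descent lemma for U₀ in block m costs t² L_m/2 ‖y_m - x_m‖², at most tλ* L_m/2 ‖y_m - x_m‖²
because t ≤ λ*. Summed over m, these terms and the linear ones are t times the strong-convexity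
lower bound for U₀(y) - U₀(x). The separable part only needs convexity of each V_m. -/
theorem IsBlockConvexSmooth.sum_le (h : IsBlockConvexSmooth U U₀ V Lb lamStar) {t : ℝ}
    (ht0 : 0 ≤ t) (ht1 : t ≤ 1) (ht : t ≤ lamStar) (x y : BlockSpace d) :
    ∑ m, U (replaceBlock m ((1 - t) • x m + t • y m) x) ≤ (M - t) * U x + t * U y := by
  have hdiff : Differentiable ℝ U₀ := h.contDiff.differentiable one_ne_zero
  have hU₀ : ∀ m, U₀ (replaceBlock m ((1 - t) • x m + t • y m) x) ≤
      U₀ x + t * fderiv ℝ U₀ x (blockInclusion m ((y - x) m)) +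
        t * (lamStar / 2 * (Lb m * ‖(y - x) m‖ ^ 2)) := by
    intro m
    have h1 := (h.block_smooth m x).le_add (x m) (t • (y - x) m)
    have h2 : x m + t • (y - x) m = (1 - t) • x m + t • y m := by
      simp only [PiLp.sub_apply]; module
    have h3 : replaceBlock m (x m) x = x := by rw [replaceBlock_eq_add]; simp
    rw [h2, (hasFDerivAt_comp_replaceBlock hdiff m x (x m)).fderiv, h3, norm_smul, mul_pow, Real.norm_eq_abs, sq_abs] at h1
    simp only [ContinuousLinearMap.comp_apply, map_smul, smul_eq_mul] at h1
    have h7 : t ^ 2 * (Lb m * ‖(y - x) m‖ ^ 2) ≤ t * lamStar * (Lb m * ‖(y - x) m‖ ^ 2) := by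
      have := (h.Lb_pos m).le
      gcongr
      nlinarith
    linarith
  have hV : ∀ m, ∑ i, V i (replaceBlock m ((1 - t) • x m + t • y m) x i) ≤
      ∑ i, V i (x i) + t * (V m (y m) - V m (x m)) := by
    intro m
    have h1 : ∑ i, V i (replaceBlock m ((1 - t) • x m + t • y m) x i) - ∑ i, V i (x i) =
        V m ((1 - t) • x m + t • y m) - V m (x m) := by
      rw [← Finset.sum_sub_distrib, Finset.sum_eq_single m]
      · rw [replaceBlock_self]
      · intro i _ hi
        rw [replaceBlock_of_ne hi, sub_self]
      · simp
    have h2 := (h.convex_V m).2 (Set.mem_univ (x m)) (Set.mem_univ (y m)) (sub_nonneg.2 ht1) ht0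
      (by ring)
    simp only [smul_eq_mul] at h2
    linarith
  have hlow := h.strongly_convex.add_fderiv_add_le (x := x) hdiff
    (weighted_norm_sq_add_smul lamStar Lb) (y - x)
  rw [add_sub_cancel] at hlow
  have hsum : ∑ m, fderiv ℝ U₀ x (blockInclusion m ((y - x) m)) = fderiv ℝ U₀ x (y - x) := by
    rw [← map_sum, sum_blockInclusion]
  calc ∑ m, U (replaceBlock m ((1 - t) • x m + t • y m) x)
      ≤ ∑ m : Fin M, ((U₀ x + t * fderiv ℝ U₀ x (blockInclusion m ((y - x) m)) +
        t * (lamStar / 2 * (Lb m * ‖(y - x) m‖ ^ 2))) +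
        (∑ i, V i (x i) + t * (V m (y m) - V m (x m)))) := by
        refine Finset.sum_le_sum fun m _ => ?_
        rw [h.decomp]
        exact add_le_add (hU₀ m) (hV m)
    _ = M * U x + t * (fderiv ℝ U₀ x (y - x) + lamStar / 2 * ∑ m, Lb m * ‖(y - x) m‖ ^ 2) +
        t * (∑ m, V m (y m) - ∑ m, V m (x m)) := by
        simp only [Finset.sum_add_distrib, ← Finset.mul_sum, Finset.sum_sub_distrib, hsum,
          Finset.sum_const, Finset.card_univ, Fintype.card_fin, nsmul_eq_mul, h.decomp x]
        ring
    _ ≤ (M - t) * U x + t * U y := by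
        rw [h.decomp x, h.decomp y]
        nlinarith [mul_le_mul_of_nonneg_left hlow ht0]

/-- Block inclusions are isometric, so restricting to a block preserves the Lipschitz constant L of
the gradient; equal weights L turn λ into λ/L. -/
theorem IsConvexSmooth.isBlockConvexSmooth [Nontrivial (BlockSpace d)] {L lam : ℝ}
    (h : IsConvexSmooth U L lam) :
    IsBlockConvexSmooth U U (fun _ _ => 0) (fun _ => L) (lam / L) := by
  have hL : 0 < L := h.lam_pos.trans_le h.lam_le
  refine ⟨fun x => by simp, fun m => convexOn_const _ convex_univ, h.smooth.contDiff, fun _ => hL,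
    fun m xbar => ⟨?_, fun y z => ?_⟩, div_pos h.lam_pos hL, ?_⟩
  · exact fun y => (hasFDerivAt_comp_replaceBlock h.smooth.1 m xbar y).differentiableAt
  · have hE : ‖(blockInclusion m : _ →L[ℝ] BlockSpace d)‖ ≤ 1 :=
      ContinuousLinearMap.opNorm_le_bound _ zero_le_one fun v => by
        rw [norm_blockInclusion_apply, one_mul]
    have hyz : replaceBlock m y xbar - replaceBlock m z xbar = blockInclusion m (y - z) := by
      rw [replaceBlock_eq_add, replaceBlock_eq_add, add_sub_add_left_eq_sub, ← map_sub,
        sub_sub_sub_cancel_right]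
    rw [norm_gradient_sub_gradient, (hasFDerivAt_comp_replaceBlock h.smooth.1 m xbar y).fderiv,
      (hasFDerivAt_comp_replaceBlock h.smooth.1 m xbar z).fderiv,
      ← ContinuousLinearMap.sub_comp]
    calc _ ≤ ‖fderiv ℝ U (replaceBlock m y xbar) - fderiv ℝ U (replaceBlock m z xbar)‖ *
          ‖(blockInclusion m : _ →L[ℝ] BlockSpace d)‖ := ContinuousLinearMap.opNorm_comp_le _ _
      _ ≤ (L * ‖blockInclusion m (y - z)‖) * 1 := by
          gcongr
          rw [← norm_gradient_sub_gradient, ← hyz]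
          exact h.smooth.2 _ _
      _ = L * ‖y - z‖ := by rw [norm_blockInclusion_apply, mul_one]
  · refine h.strongly_convex.congr fun x _ => ?_
    simp only [← Finset.mul_sum, PiLp.norm_sq_eq_of_L2]
    field_simp

end Block

/-! ### Block updates acting on densities -/

section BlockMean

variable {M : ℕ} {d : Fin M → ℕ}

theorem replaceBlock_replaceBlock (m : Fin M) (y y' : EuclideanSpace ℝ (Fin (d m)))
    (x : BlockSpace d) : replaceBlock m y (replaceBlock m y' x) = replaceBlock m y x := by
  simp [replaceBlock]

theorem replaceBlock_apply_self (m : Fin M) (x : BlockSpace d) : replaceBlock m (x m) x = x := by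
  rw [replaceBlock_eq_add]; simp

theorem dropBlock_replaceBlock (m : Fin M) (y : EuclideanSpace ℝ (Fin (d m)))
    (x : BlockSpace d) : dropBlock m (replaceBlock m y x) = dropBlock m x := by
  ext1 i
  exact replaceBlock_of_ne i.2 y x

/-- The point with the given blocks other than the `m`-th one, and `m`-th block `0`. -/
def extendBlock (m : Fin M) (o : OtherBlocks d m) : BlockSpace d :=
  WithLp.toLp 2 fun i => if h : i ≠ m then o ⟨i, h⟩ else 0

theorem measurable_extendBlock (m : Fin M) : Measurable (extendBlock (d := d) m) := by
  refine (WithLp.measurable_toLp 2 _).comp (measurable_pi_lambda _ fun i => ?_)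
  by_cases h : i = m
  · simp [h]
  · simp only [ne_eq, h, not_false_eq_true, dite_true]
    fun_prop

theorem replaceBlock_extendBlock_dropBlock (m : Fin M) (y : EuclideanSpace ℝ (Fin (d m)))
    (x : BlockSpace d) : replaceBlock m y (extendBlock m (dropBlock m x)) = replaceBlock m y x := by
  ext1 i
  by_cases h : i = m
  · subst h; simp [replaceBlock_self]
  · simp [replaceBlock_of_ne h, extendBlock, dropBlock, h]

variable (π : Measure (BlockSpace d)) [IsProbabilityMeasure π]

instance (m : Fin M) : IsMarkovKernel (fullConditional π m) := by
  unfold fullConditional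
  infer_instance

theorem measurable_replaceBlock_left (m : Fin M) (x : BlockSpace d) :
    Measurable fun y => replaceBlock m y x :=
  (measurable_replaceBlock (d := d) m).comp measurable_prodMk_left

theorem blockUpdateKernel_apply (m : Fin M) (x : BlockSpace d) :
    blockUpdateKernel π m x =
      (fullConditional π m (dropBlock m x)).map (fun y => replaceBlock m y x) := rfl

instance (m : Fin M) : IsMarkovKernel (blockUpdateKernel π m) := ⟨fun x => by
  rw [blockUpdateKernel_apply]
  exact Measure.isProbabilityMeasure_map (measurable_replaceBlock_left m x).aemeasurable⟩

/-- `P_m f`: the mean of `f` after an update of the `m`-th block. -/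
def blockMean (m : Fin M) (f : BlockSpace d → ℝ≥0∞) (x : BlockSpace d) : ℝ≥0∞ :=
  ∫⁻ z, f z ∂(blockUpdateKernel π m x)

variable {π} {m : Fin M} {f g : BlockSpace d → ℝ≥0∞}

theorem measurable_blockMean (hf : Measurable f) : Measurable (blockMean π m f) :=
  hf.lintegral_kernel

theorem blockMean_eq (hf : Measurable f) (x : BlockSpace d) :
    blockMean π m f x = ∫⁻ y, f (replaceBlock m y x) ∂(fullConditional π m (dropBlock m x)) := by
  rw [blockMean, blockUpdateKernel_apply, lintegral_map hf (measurable_replaceBlock_left m x)]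

theorem blockMean_replaceBlock (hf : Measurable f) (x : BlockSpace d)
    (y : EuclideanSpace ℝ (Fin (d m))) :
    blockMean π m f (replaceBlock m y x) = blockMean π m f x := by
  rw [blockMean_eq hf, blockMean_eq hf]
  simp_rw [dropBlock_replaceBlock, replaceBlock_replaceBlock]

theorem blockMean_le {C : ℝ≥0∞} (hf : ∀ x, f x ≤ C) (x : BlockSpace d) :
    blockMean π m f x ≤ C := by
  calc blockMean π m f x ≤ ∫⁻ _, C ∂(blockUpdateKernel π m x) := lintegral_mono hf
    _ = C := by simp

/-- Invariance of π under P_m: the law of x_{-m} composed with the conditional law is the joint law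
of (x_{-m}, x_m). Extending by a zero block writes the integrand as a function of that pair. -/
theorem lintegral_blockMean (hf : Measurable f) : ∫⁻ x, blockMean π m f x ∂π = ∫⁻ x, f x ∂π := by
  set Ψ : OtherBlocks d m × EuclideanSpace ℝ (Fin (d m)) → BlockSpace d :=
    fun p => replaceBlock m p.2 (extendBlock m p.1) with hΨ
  have hΨm : Measurable Ψ := (measurable_replaceBlock m).comp
    (((measurable_extendBlock m).comp measurable_fst).prodMk measurable_snd)
  have hX : Measurable fun x : BlockSpace d => x m := by fun_prop
  have h1 : ∀ x, blockMean π m f x =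
      ∫⁻ y, f (Ψ (dropBlock m x, y)) ∂(fullConditional π m (dropBlock m x)) := fun x => by
    rw [blockMean_eq hf]
    simp_rw [hΨ, replaceBlock_extendBlock_dropBlock]
  have h2 : Measurable fun o =>
      ∫⁻ y, f (Ψ (o, y)) ∂(fullConditional π m o) :=
    Measurable.lintegral_kernel_prod_right' (hf.comp hΨm)
  simp_rw [h1]
  rw [← lintegral_map (f := fun o => ∫⁻ y, f (Ψ (o, y)) ∂(fullConditional π m o)) h2
    (measurable_dropBlock m),
    ← Measure.lintegral_compProd (f := fun p => f (Ψ p)) (hf.comp hΨm), fullConditional,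
    compProd_map_condDistrib hX.aemeasurable,
    lintegral_map (f := fun p => f (Ψ p)) (hf.comp hΨm) ((measurable_dropBlock m).prodMk hX)]
  simp_rw [hΨ, replaceBlock_extendBlock_dropBlock, replaceBlock_apply_self]

theorem blockMean_mul (hf : Measurable f) (hg : Measurable g)
    (hinv : ∀ x y, g (replaceBlock m y x) = g x) (x : BlockSpace d) :
    blockMean π m (fun z => g z * f z) x = g x * blockMean π m f x := by
  rw [blockMean_eq (f := fun z => g z * f z) (hg.mul hf), blockMean_eq hf]
  simp_rw [hinv]
  exact lintegral_const_mul _ (hf.comp (measurable_replaceBlock_left m x))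

theorem lintegral_mul_blockMean (hf : Measurable f) (hg : Measurable g)
    (hinv : ∀ x y, g (replaceBlock m y x) = g x) :
    ∫⁻ x, g x * blockMean π m f x ∂π = ∫⁻ x, g x * f x ∂π := by
  simp_rw [← blockMean_mul hf hg hinv]
  exact lintegral_blockMean (hg.mul hf)

/-- Reversibility: P_m is a conditional expectation, so both sides equal the integral of the product
of the two block means. -/
theorem lintegral_blockMean_mul (hf : Measurable f) (hg : Measurable g) :
    ∫⁻ x, blockMean π m g x * f x ∂π = ∫⁻ x, blockMean π m f x * g x ∂π := by
  rw [← lintegral_mul_blockMean hf (measurable_blockMean hg) (blockMean_replaceBlock hg),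
    ← lintegral_mul_blockMean hg (measurable_blockMean hf) (blockMean_replaceBlock hf)]
  simp_rw [mul_comm]

/-- The density of `μ P^GS` when `μ` has density `f`. -/
def gibbsMean (π : Measure (BlockSpace d)) [IsProbabilityMeasure π] (f : BlockSpace d → ℝ≥0∞)
    (x : BlockSpace d) : ℝ≥0∞ :=
  (M : ℝ≥0∞)⁻¹ * ∑ m, blockMean π m f x

theorem measurable_gibbsMean (hf : Measurable f) : Measurable (gibbsMean π f) :=
  (Finset.measurable_sum _ fun _ _ => measurable_blockMean hf).const_mul _

theorem gibbsMean_le (hM : 1 ≤ M) {C : ℝ≥0∞} (hf : ∀ x, f x ≤ C) (x : BlockSpace d) :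
    gibbsMean π f x ≤ C := by
  have hM0 : (M : ℝ≥0∞) ≠ 0 := by exact_mod_cast (by omega : M ≠ 0)
  calc gibbsMean π f x ≤ (M : ℝ≥0∞)⁻¹ * ∑ _m : Fin M, C := by
        unfold gibbsMean
        gcongr with m
        exact blockMean_le hf x
    _ = C := by
        rw [Finset.sum_const, Finset.card_univ, Fintype.card_fin, nsmul_eq_mul, ← mul_assoc,
          ENNReal.inv_mul_cancel hM0 (ENNReal.natCast_ne_top M), one_mul]

theorem lintegral_gibbsMean (hM : 1 ≤ M) (hf : Measurable f) :
    ∫⁻ x, gibbsMean π f x ∂π = ∫⁻ x, f x ∂π := by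
  have hM0 : (M : ℝ≥0∞) ≠ 0 := by exact_mod_cast (by omega : M ≠ 0)
  unfold gibbsMean
  rw [lintegral_const_mul _ (Finset.measurable_sum _ fun _ _ => measurable_blockMean hf),
    lintegral_finsetSum _ fun _ _ => measurable_blockMean hf]
  simp_rw [lintegral_blockMean hf]
  rw [Finset.sum_const, Finset.card_univ, Fintype.card_fin, nsmul_eq_mul, ← mul_assoc,
    ENNReal.inv_mul_cancel hM0 (ENNReal.natCast_ne_top M), one_mul]

/-- By reversibility, densities evolve under the same operator as test functions. -/
theorem bind_gibbsKernel_withDensity (hf : Measurable f) :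
    (π.withDensity f).bind (gibbsKernel π) = π.withDensity (gibbsMean π f) := by
  ext s hs
  have hind : Measurable (s.indicator (1 : BlockSpace d → ℝ≥0∞)) := measurable_one.indicator hs
  have hk : ∀ x, gibbsKernel π x s =
      (M : ℝ≥0∞)⁻¹ * ∑ m, blockMean π m (s.indicator 1) x := fun x => by
    simp only [blockMean, lintegral_indicator_one hs]
    change ((M : ENNReal)⁻¹ • ∑ m, blockUpdateKernel π m x) s = _
    simp [Measure.coe_finsetSum]
  rw [Measure.bind_apply hs (gibbsKernel π).measurable.aemeasurable, withDensity_apply _ hs]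
  simp_rw [hk]
  rw [lintegral_withDensity_eq_lintegral_mul _ hf
    ((Finset.measurable_sum _ fun _ _ => measurable_blockMean hind).const_mul _),
    ← lintegral_indicator hs]
  have h1 : ∀ x, (f * fun x => (M : ℝ≥0∞)⁻¹ * ∑ m, blockMean π m (s.indicator 1) x) x =
      (M : ℝ≥0∞)⁻¹ * ∑ m, blockMean π m (s.indicator 1) x * f x := fun x => by
    simp only [Pi.mul_apply, ← Finset.sum_mul]; ring
  have h2 : ∀ x, s.indicator (gibbsMean π f) x =
      (M : ℝ≥0∞)⁻¹ * ∑ m, blockMean π m f x * s.indicator 1 x := fun x => by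
    by_cases hx : x ∈ s <;> simp [hx, gibbsMean]
  simp_rw [h1, h2]
  have hm1 : ∀ m, Measurable fun x => blockMean π m (s.indicator 1) x * f x := fun m =>
    (measurable_blockMean hind).mul hf
  have hm2 : ∀ m, Measurable fun x => blockMean π m f x * s.indicator 1 x := fun m =>
    (measurable_blockMean hf).mul hind
  rw [lintegral_const_mul _ (Finset.measurable_sum _ fun m _ => hm1 m),
    lintegral_const_mul _ (Finset.measurable_sum _ fun m _ => hm2 m),
    lintegral_finsetSum _ fun m _ => hm1 m, lintegral_finsetSum _ fun m _ => hm2 m]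
  simp_rw [lintegral_blockMean_mul hf hind]

end BlockMean

/-! ### Entropy of bounded densities -/

section Entropy

/-- `f` is a probability density with respect to `π`, bounded by `C`. -/
structure IsBoundedDensity {X : Type*} [MeasurableSpace X] (π : Measure X) (C : ℝ)
    (f : X → ℝ≥0∞) : Prop where
  measurable : Measurable f
  le : ∀ x, f x ≤ ENNReal.ofReal C
  lintegral_eq : ∫⁻ x, f x ∂π = 1

/-- `∫ f log f dπ`. -/
def densityEntropy {X : Type*} [MeasurableSpace X] (π : Measure X) (f : X → ℝ≥0∞) : ℝ :=
  ∫ x, (f x).toReal * Real.log (f x).toReal ∂π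

variable {X : Type*} [MeasurableSpace X] {π : Measure X} {C : ℝ} {f : X → ℝ≥0∞}

theorem IsBoundedDensity.lt_top (h : IsBoundedDensity π C f) (x : X) : f x < ∞ :=
  (h.le x).trans_lt ENNReal.ofReal_lt_top

theorem IsBoundedDensity.pos (h : IsBoundedDensity π C f) : 0 < C := by
  by_contra! hC
  have : ∀ x, f x = 0 := fun x => le_antisymm ((h.le x).trans (by simp [hC])) bot_le
  simpa [this] using h.lintegral_eq

theorem IsBoundedDensity.toReal_le (h : IsBoundedDensity π C f) (x : X) : (f x).toReal ≤ C :=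
  ENNReal.toReal_le_of_le_ofReal h.pos.le (h.le x)

theorem IsBoundedDensity.integrable_comp [IsFiniteMeasure π] (h : IsBoundedDensity π C f)
    {φ : ℝ → ℝ} (hφ : Continuous φ) : Integrable (fun x => φ (f x).toReal) π := by
  obtain ⟨B, hB⟩ := (isCompact_Icc (a := (0 : ℝ)) (b := C)).exists_bound_of_continuousOn
    hφ.continuousOn
  exact Integrable.of_bound (hφ.measurable.comp h.measurable.ennreal_toReal).aestronglyMeasurable B
    (Filter.Eventually.of_forall fun x => hB _ ⟨ENNReal.toReal_nonneg, h.toReal_le x⟩)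

theorem IsBoundedDensity.integral_toReal (h : IsBoundedDensity π C f) :
    ∫ x, (f x).toReal ∂π = 1 := by
  rw [MeasureTheory.integral_toReal h.measurable.aemeasurable
    (Filter.Eventually.of_forall h.lt_top), h.lintegral_eq, ENNReal.toReal_one]

theorem IsBoundedDensity.isProbabilityMeasure (h : IsBoundedDensity π C f) :
    IsProbabilityMeasure (π.withDensity f) :=
  ⟨by rw [withDensity_apply _ MeasurableSet.univ, Measure.restrict_univ, h.lintegral_eq]⟩

/-- The correction 1 - u in klFun u = u log u + 1 - u integrates to zero. -/
theorem IsBoundedDensity.integral_klFun [IsProbabilityMeasure π] (h : IsBoundedDensity π C f) :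
    ∫ x, InformationTheory.klFun (f x).toReal ∂π = densityEntropy π f := by
  have h1 := h.integrable_comp Real.continuous_mul_log
  have h2 : Integrable (fun x => (f x).toReal) π := h.integrable_comp continuous_id
  have h3 : Integrable (fun x => (f x).toReal * Real.log (f x).toReal + 1) π :=
    h1.add (integrable_const 1)
  simp only [InformationTheory.klFun, densityEntropy]
  rw [integral_sub h3 h2, integral_add h1 (integrable_const 1), h.integral_toReal]
  simp

theorem IsBoundedDensity.klDiv_eq [IsProbabilityMeasure π] (h : IsBoundedDensity π C f) :
    InformationTheory.klDiv (π.withDensity f) π = ENNReal.ofReal (densityEntropy π f) := by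
  have := h.isProbabilityMeasure
  rw [InformationTheory.klDiv_eq_lintegral_klFun_of_ac (withDensity_absolutelyContinuous _ _),
    ← h.integral_klFun, ofReal_integral_eq_lintegral_ofReal
      (h.integrable_comp InformationTheory.continuous_klFun)
      (Filter.Eventually.of_forall fun x => InformationTheory.klFun_nonneg ENNReal.toReal_nonneg)]
  refine lintegral_congr_ae ?_
  filter_upwards [Measure.rnDeriv_withDensity π h.measurable] with x hx
  rw [hx]

theorem IsBoundedDensity.densityEntropy_le [IsProbabilityMeasure π]
    (h : IsBoundedDensity π C f) : densityEntropy π f ≤ Real.log C := by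
  have h2 : Integrable (fun x => (f x).toReal) π := h.integrable_comp continuous_id
  calc densityEntropy π f ≤ ∫ x, (f x).toReal * Real.log C ∂π := by
        refine integral_mono (h.integrable_comp Real.continuous_mul_log) (h2.mul_const _) fun x => ?_
        rcases (ENNReal.toReal_nonneg (a := f x)).eq_or_lt with h0 | h0
        · simp [← h0]
        · exact mul_le_mul_of_nonneg_left (Real.log_le_log h0 (h.toReal_le x)) h0.le
    _ = Real.log C := by rw [integral_mul_const, h.integral_toReal, one_mul]

theorem IsBoundedDensity.exists_of_le [IsProbabilityMeasure π] {μ : Measure X}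
    [IsProbabilityMeasure μ] (h : ∀ A, MeasurableSet A → μ A ≤ ENNReal.ofReal C * π A) :
    ∃ f, IsBoundedDensity π C f ∧ μ = π.withDensity f := by
  have hac : μ ≪ π := Measure.AbsolutelyContinuous.mk fun s hs h0 => by
    simpa [h0] using h s hs
  have hle : μ.rnDeriv π ≤ᵐ[π] fun _ => ENNReal.ofReal C := by
    refine ae_le_of_forall_setLIntegral_le_of_sigmaFinite (Measure.measurable_rnDeriv μ π)
      fun s hs _ => ?_
    rw [setLIntegral_const, Measure.setLIntegral_rnDeriv hac]
    exact h s hs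
  -- Truncation makes the bound hold everywhere, as `IsBoundedDensity` asks, rather than almost
  -- everywhere.
  have heq : (fun x => min (μ.rnDeriv π x) (ENNReal.ofReal C)) =ᵐ[π] μ.rnDeriv π := by
    filter_upwards [hle] with x hx
    exact min_eq_left hx
  have hμ : μ = π.withDensity fun x => min (μ.rnDeriv π x) (ENNReal.ofReal C) := by
    rw [withDensity_congr_ae heq, Measure.withDensity_rnDeriv_eq _ _ hac]
  refine ⟨_, ⟨(Measure.measurable_rnDeriv μ π).min measurable_const, fun x => min_le_right _ _, ?_⟩,
    hμ⟩
  rw [← setLIntegral_univ, ← withDensity_apply _ MeasurableSet.univ, ← hμ, measure_univ]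

end Entropy

/-! ### Entropy contraction under one Gibbs step -/

section Contraction

variable {M : ℕ} {d : Fin M → ℕ} {π : Measure (BlockSpace d)} [IsProbabilityMeasure π] {C : ℝ}
  {f : BlockSpace d → ℝ≥0∞}

theorem IsBoundedDensity.blockMean (h : IsBoundedDensity π C f) (m : Fin M) :
    IsBoundedDensity π C (blockMean π m f) :=
  ⟨measurable_blockMean h.measurable, blockMean_le h.le,
    (lintegral_blockMean h.measurable).trans h.lintegral_eq⟩

theorem IsBoundedDensity.gibbsMean (hM : 1 ≤ M) (h : IsBoundedDensity π C f) :
    IsBoundedDensity π C (gibbsMean π f) :=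
  ⟨measurable_gibbsMean h.measurable, gibbsMean_le hM h.le,
    (lintegral_gibbsMean hM h.measurable).trans h.lintegral_eq⟩

theorem map_withDensity_blockMean (m : Fin M) (hf : Measurable f) {φ : BlockSpace d → ℝ}
    (hφ : Measurable φ) (hinv : ∀ x y, φ (replaceBlock m y x) = φ x) :
    (π.withDensity (_root_.blockMean π m f)).map φ = (π.withDensity f).map φ := by
  ext s hs
  have hs' := hφ hs
  have hind : Measurable ((φ ⁻¹' s).indicator (1 : BlockSpace d → ℝ≥0∞)) :=
    measurable_one.indicator hs'
  rw [Measure.map_apply hφ hs, Measure.map_apply hφ hs, withDensity_apply _ hs',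
    withDensity_apply _ hs', ← lintegral_indicator hs', ← lintegral_indicator hs']
  have h1 : ∀ (u : BlockSpace d → ℝ≥0∞) x,
      (φ ⁻¹' s).indicator u x = (φ ⁻¹' s).indicator 1 x * u x := fun u x => by
    by_cases hx : x ∈ φ ⁻¹' s <;> simp [hx]
  simp_rw [h1 f, h1 (_root_.blockMean π m f)]
  refine lintegral_mul_blockMean hf hind fun x y => ?_
  have e : replaceBlock m y x ∈ φ ⁻¹' s ↔ x ∈ φ ⁻¹' s := by
    rw [Set.mem_preimage, Set.mem_preimage, hinv]
  by_cases hx : x ∈ φ ⁻¹' s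
  · rw [Set.indicator_of_mem hx, Set.indicator_of_mem (e.2 hx)]; rfl
  · rw [Set.indicator_of_notMem hx, Set.indicator_of_notMem (mt e.1 hx)]

/-- The function log P_m f ignores block m, so it has the same law under f π and under (P_m f) π.
Comparing laws transfers integrability as well as the integral, although log P_m f has no lower
bound. -/
theorem IsBoundedDensity.integrable_mul_log_blockMean (h : IsBoundedDensity π C f) (m : Fin M) :
    Integrable (fun x => (f x).toReal * Real.log (_root_.blockMean π m f x).toReal) π ∧
      ∫ x, (f x).toReal * Real.log (_root_.blockMean π m f x).toReal ∂π =
        densityEntropy π (_root_.blockMean π m f) := by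
  have hm := h.blockMean m
  set φ : BlockSpace d → ℝ := fun x => Real.log (_root_.blockMean π m f x).toReal with hφ
  have hφm : Measurable φ := hm.measurable.ennreal_toReal.log
  have hmap := map_withDensity_blockMean (π := π) m h.measurable hφm fun x y => by
    simp only [hφ, blockMean_replaceBlock h.measurable]
  have e1 := integrable_withDensity_iff_integrable_smul' (μ := π) (g := φ) h.measurable
    (Filter.Eventually.of_forall h.lt_top)
  have e2 := integrable_withDensity_iff_integrable_smul' (μ := π) (g := φ) hm.measurable
    (Filter.Eventually.of_forall hm.lt_top)
  have e3 := integral_withDensity_eq_integral_toReal_smul (μ := π) h.measurable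
    (Filter.Eventually.of_forall h.lt_top) φ
  have e4 := integral_withDensity_eq_integral_toReal_smul (μ := π) hm.measurable
    (Filter.Eventually.of_forall hm.lt_top) φ
  have hid : ∀ ν : Measure ℝ, AEStronglyMeasurable (id : ℝ → ℝ) ν := fun ν =>
    measurable_id.aestronglyMeasurable
  have i1 := integrable_map_measure (hid ((π.withDensity f).map φ)) hφm.aemeasurable
  have i2 := integrable_map_measure (hid ((π.withDensity (_root_.blockMean π m f)).map φ))
    hφm.aemeasurable
  have j1 := integral_map hφm.aemeasurable (hid ((π.withDensity f).map φ))
  have j2 := integral_map hφm.aemeasurable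
    (hid ((π.withDensity (_root_.blockMean π m f)).map φ))
  simp only [smul_eq_mul, Function.id_comp, id] at *
  constructor
  · rw [← e1, ← i1, ← hmap, i2, e2]
    exact hm.integrable_comp Real.continuous_mul_log
  · rw [densityEntropy, ← e3, ← j1, ← hmap, j2, e4]

/-- The set where P_m f = 0 is independent of block m, so f and P_m f have the same integral over
it, namely 0. -/
theorem IsBoundedDensity.ae_blockMean_ne_zero (h : IsBoundedDensity π C f) (m : Fin M) :
    ∀ᵐ x ∂π, f x ≠ 0 → _root_.blockMean π m f x ≠ 0 := by
  set g : BlockSpace d → ℝ≥0∞ := {x | _root_.blockMean π m f x = 0}.indicator 1 with hg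
  have hs : MeasurableSet {x | _root_.blockMean π m f x = 0} :=
    (h.blockMean m).measurable (measurableSet_singleton 0)
  have hgm : Measurable g := measurable_one.indicator hs
  have h1 := lintegral_mul_blockMean (π := π) (m := m) h.measurable hgm fun x y => by
    simp [hg, Set.indicator, blockMean_replaceBlock h.measurable]
  have h2 : ∀ x, g x * _root_.blockMean π m f x = 0 := fun x => by
    by_cases hx : _root_.blockMean π m f x = 0 <;> simp [hg, hx]
  simp_rw [h2] at h1
  rw [lintegral_zero] at h1
  have h3 := (lintegral_eq_zero_iff (hgm.mul h.measurable)).1 h1.symm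
  filter_upwards [h3] with x hx hfx h0
  simp [hg, h0, hfx] at hx

variable {U U₀ : BlockSpace d → ℝ} {V : (m : Fin M) → EuclideanSpace ℝ (Fin (d m)) → ℝ}
  {Lb : Fin M → ℝ} {lamStar : ℝ}

theorem IsBoundedDensity.lintegral_prod_blockMean_le (h : IsBoundedDensity π C f)
    (hU : IsBlockConvexSmooth U U₀ V Lb lamStar)
    (hπ : π = (volume : Measure (BlockSpace d)).withDensity
      (fun x => ENNReal.ofReal (Real.exp (-U x)))) (hM : 1 ≤ M)
    {t : ℝ} (ht0 : 0 < t) (ht1 : t < 1) (ht : t ≤ lamStar) :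
    ∫⁻ x, ∏ m, _root_.blockMean π m f x ^ (1 / ((M : ℝ) - t)) ∂π ≤ 1 := by
  have hM' : (1 : ℝ) ≤ M := by exact_mod_cast hM
  set s : ℝ := M - t with hs
  have hs0 : 0 < s := by linarith
  set E : BlockSpace d → ℝ≥0∞ := fun x => ENNReal.ofReal (Real.exp (-U x)) with hE
  have hEm : Measurable E :=
    (Real.measurable_exp.comp hU.continuous.measurable.neg).ennreal_ofReal
  have hint : ∀ u : BlockSpace d → ℝ≥0∞, Measurable u →
      ∫⁻ x, u x * E x = ∫⁻ x, u x ∂π := fun u hu => by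
    conv_rhs => rw [hπ, lintegral_withDensity_eq_lintegral_mul _ hEm hu]
    simp [mul_comm]
  have hE1 : ∫⁻ x, E x = 1 := by
    have := hint 1 measurable_one
    simpa using this
  have hbm : ∀ m, Measurable (_root_.blockMean π m f) := fun m => measurable_blockMean h.measurable
  have hprod : Measurable fun x => ∏ m, _root_.blockMean π m f x ^ (1 / s) :=
    Finset.measurable_prod _ fun m _ => (hbm m).pow_const _
  have key := lintegral_blockSpace_rpow_mul_le_prod (F := fun m x => _root_.blockMean π m f x * E x)
    (H := fun x => (∏ m, _root_.blockMean π m f x ^ (1 / s)) * E x) (K := E)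
    (fun m => (hbm m).mul hEm) (hprod.mul hEm) hEm ht0 ht1 fun x y => by
      -- Each P_m f is unchanged by the move in block m, so these factors cancel and only the
      -- inequality for U remains.
      simp only [blockMean_replaceBlock h.measurable]
      rw [Finset.prod_mul_distrib, ENNReal.mul_rpow_of_nonneg _ _ hs0.le,
        ← ENNReal.prod_rpow_of_nonneg hs0.le, mul_assoc]
      have h1 : ∀ m, (_root_.blockMean π m f x ^ (1 / s)) ^ s = _root_.blockMean π m f x :=
        fun m => by rw [← ENNReal.rpow_mul, one_div_mul_cancel hs0.ne', ENNReal.rpow_one]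
      simp_rw [h1]
      gcongr
      simp only [hE]
      rw [ENNReal.ofReal_rpow_of_pos (Real.exp_pos _), ENNReal.ofReal_rpow_of_pos (Real.exp_pos _),
        ← ENNReal.ofReal_mul (by positivity), ← ENNReal.ofReal_prod_of_nonneg
        (fun _ _ => (Real.exp_pos _).le)]
      refine ENNReal.ofReal_le_ofReal ?_
      rw [← Real.exp_mul, ← Real.exp_mul, ← Real.exp_add, ← Real.exp_sum]
      refine Real.exp_le_exp.2 ?_
      rw [Finset.sum_neg_distrib]
      linarith [hU.sum_le ht0.le ht1.le ht x y]
  rw [hE1, ENNReal.one_rpow, mul_one, hint _ hprod] at key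
  simp_rw [hint _ (hbm _), (h.blockMean _).lintegral_eq, Finset.prod_const_one] at key
  by_contra! hlt
  exact absurd key (not_le.2 (ENNReal.one_lt_rpow hlt hs0))

theorem IsBoundedDensity.sum_densityEntropy_blockMean_le_of_lt (h : IsBoundedDensity π C f)
    (hU : IsBlockConvexSmooth U U₀ V Lb lamStar)
    (hπ : π = (volume : Measure (BlockSpace d)).withDensity
      (fun x => ENNReal.ofReal (Real.exp (-U x)))) (hM : 1 ≤ M)
    {t : ℝ} (ht0 : 0 < t) (ht1 : t < 1) (ht : t ≤ lamStar) :
    ∑ m, densityEntropy π (_root_.blockMean π m f) ≤ (M - t) * densityEntropy π f := by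
  have hM' : (1 : ℝ) ≤ M := by exact_mod_cast hM
  have hle := h.lintegral_prod_blockMean_le hU hπ hM ht0 ht1 ht
  set s : ℝ := M - t with hs
  have hs0 : 0 < s := by linarith
  set g : BlockSpace d → ℝ≥0∞ := fun x => ∏ m, _root_.blockMean π m f x ^ (1 / s) with hg
  have hgm : Measurable g :=
    Finset.measurable_prod _ fun m _ => (h.blockMean m).measurable.pow_const _
  have hgint : Integrable (fun x => (g x).toReal) π :=
    integrable_toReal_of_lintegral_ne_top hgm.aemeasurable
      (ne_top_of_le_ne_top ENNReal.one_ne_top hle)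
  have hfint : Integrable (fun x => (f x).toReal) π := h.integrable_comp continuous_id
  have hgtop : ∀ x, g x < ∞ := fun x => (ENNReal.prod_ne_top fun m _ =>
    ENNReal.rpow_ne_top_of_nonneg (by positivity) ((h.blockMean m).lt_top x).ne).lt_top
  have hgle : ∫ x, (g x).toReal ∂π ≤ 1 := by
    rw [MeasureTheory.integral_toReal hgm.aemeasurable (Filter.Eventually.of_forall hgtop)]
    exact ENNReal.toReal_le_of_le_ofReal zero_le_one (by simpa using hle)
  have hflog := h.integrable_comp Real.continuous_mul_log
  have hsumint : Integrable (fun x => ∑ m, (f x).toReal *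
      Real.log (_root_.blockMean π m f x).toReal) π :=
    integrable_finsetSum _ fun m _ => (h.integrable_mul_log_blockMean m).1
  have hmain : ∫ x, ((1 / s) * ∑ m, (f x).toReal * Real.log (_root_.blockMean π m f x).toReal -
      (f x).toReal * Real.log (f x).toReal) ∂π ≤ ∫ x, ((g x).toReal - (f x).toReal) ∂π := by
    refine integral_mono_ae ((hsumint.const_mul _).sub hflog) (hgint.sub hfint) ?_
    filter_upwards [ae_all_iff.2 fun m => h.ae_blockMean_ne_zero m] with x hx
    by_cases hf0 : f x = 0
    · simp [hf0]
    have hfpos : 0 < (f x).toReal := ENNReal.toReal_pos hf0 (h.lt_top x).ne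
    have hmpos : ∀ m, 0 < (_root_.blockMean π m f x).toReal := fun m =>
      ENNReal.toReal_pos (hx m hf0) ((h.blockMean m).lt_top x).ne
    have hgx : (g x).toReal = ∏ m, (_root_.blockMean π m f x).toReal ^ (1 / s) := by
      simp only [hg, ENNReal.toReal_prod, ENNReal.toReal_rpow]
    have hgpos : 0 < (g x).toReal := by
      rw [hgx]; exact Finset.prod_pos fun m _ => Real.rpow_pos_of_pos (hmpos m) _
    have hlog : Real.log (g x).toReal =
        (1 / s) * ∑ m, Real.log (_root_.blockMean π m f x).toReal := by
      rw [hgx, Real.log_prod fun m _ => (Real.rpow_pos_of_pos (hmpos m) _).ne', Finset.mul_sum]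
      exact Finset.sum_congr rfl fun m _ => Real.log_rpow (hmpos m) _
    -- Gibbs' inequality in pointwise form: f log(g/f) ≤ g - f.
    have h1 := Real.log_le_sub_one_of_pos (div_pos hgpos hfpos)
    rw [Real.log_div hgpos.ne' hfpos.ne', hlog] at h1
    have h2 := mul_le_mul_of_nonneg_left h1 hfpos.le
    rw [mul_sub, mul_sub, mul_one, mul_div_cancel₀ _ hfpos.ne'] at h2
    rw [← Finset.mul_sum]
    linarith
  rw [integral_sub (hsumint.const_mul _) hflog, integral_sub hgint hfint, h.integral_toReal,
    integral_const_mul, integral_finsetSum _ fun m _ => (h.integrable_mul_log_blockMean m).1]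
    at hmain
  simp_rw [(h.integrable_mul_log_blockMean _).2] at hmain
  rw [← densityEntropy] at hmain
  have h3 : (1 / s) * ∑ m, densityEntropy π (_root_.blockMean π m f) ≤ densityEntropy π f := by
    linarith
  rw [one_div, inv_mul_le_iff₀ hs0] at h3
  exact h3

theorem IsBoundedDensity.sum_densityEntropy_blockMean_le (h : IsBoundedDensity π C f)
    (hU : IsBlockConvexSmooth U U₀ V Lb lamStar)
    (hπ : π = (volume : Measure (BlockSpace d)).withDensity
      (fun x => ENNReal.ofReal (Real.exp (-U x)))) (hM : 1 ≤ M) (hlam : lamStar ≤ 1) :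
    ∑ m, densityEntropy π (_root_.blockMean π m f) ≤ (M - lamStar) * densityEntropy π f := by
  have hlim : Filter.Tendsto (fun t : ℝ => (M - t) * densityEntropy π f)
      (nhdsWithin lamStar (Set.Iio lamStar)) (nhds ((M - lamStar) * densityEntropy π f)) :=
    (Continuous.tendsto (by fun_prop) _).mono_left nhdsWithin_le_nhds
  -- The case λ* = 1 is allowed while Prékopa–Leindler needs t < 1; hence a limit t ↑ λ*.
  refine ge_of_tendsto hlim ?_
  filter_upwards [Ioo_mem_nhdsLT hU.lamStar_pos] with t ht
  exact h.sum_densityEntropy_blockMean_le_of_lt hU hπ hM ht.1 (ht.2.trans_le hlam) ht.2.le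

/-- Jensen's inequality for klFun applied to the average of the P_m f, followed by the bound on the
sum of their entropies. -/
theorem IsBoundedDensity.densityEntropy_gibbsMean_le (h : IsBoundedDensity π C f)
    (hU : IsBlockConvexSmooth U U₀ V Lb lamStar)
    (hπ : π = (volume : Measure (BlockSpace d)).withDensity
      (fun x => ENNReal.ofReal (Real.exp (-U x)))) (hM : 1 ≤ M) (hlam : lamStar ≤ 1) :
    densityEntropy π (_root_.gibbsMean π f) ≤ (1 - lamStar / M) * densityEntropy π f := by
  have hM0 : (0 : ℝ) < M := by exact_mod_cast hM
  have hg := h.gibbsMean hM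
  have hint : ∀ m, Integrable
      (fun x => InformationTheory.klFun (_root_.blockMean π m f x).toReal) π := fun m =>
    (h.blockMean m).integrable_comp InformationTheory.continuous_klFun
  calc densityEntropy π (_root_.gibbsMean π f)
      = ∫ x, InformationTheory.klFun (_root_.gibbsMean π f x).toReal ∂π := hg.integral_klFun.symm
    _ ≤ ∫ x, ∑ m, (M : ℝ)⁻¹ * InformationTheory.klFun (_root_.blockMean π m f x).toReal ∂π := by
        refine integral_mono (hg.integrable_comp InformationTheory.continuous_klFun)
          (integrable_finsetSum _ fun m _ => (hint m).const_mul _) fun x => ?_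
        have h1 := InformationTheory.convexOn_klFun.map_sum_le (t := Finset.univ)
          (w := fun _ : Fin M => (M : ℝ)⁻¹) (p := fun m => (_root_.blockMean π m f x).toReal)
          (fun _ _ => by positivity) (by simp [hM0.ne']) (fun m _ => ENNReal.toReal_nonneg)
        have h2 : (_root_.gibbsMean π f x).toReal =
            ∑ m, (M : ℝ)⁻¹ • (_root_.blockMean π m f x).toReal := by
          rw [_root_.gibbsMean, ENNReal.toReal_mul, ENNReal.toReal_inv, ENNReal.toReal_natCast,
            ENNReal.toReal_sum fun m _ => ((h.blockMean m).lt_top x).ne, Finset.mul_sum]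
          rfl
        simp only [h2]
        simpa using h1
    _ = (M : ℝ)⁻¹ * ∑ m, densityEntropy π (_root_.blockMean π m f) := by
        rw [integral_finsetSum _ fun m _ => (hint m).const_mul _, Finset.mul_sum]
        refine Finset.sum_congr rfl fun m _ => ?_
        rw [integral_const_mul, (h.blockMean m).integral_klFun]
    _ ≤ (M : ℝ)⁻¹ * ((M - lamStar) * densityEntropy π f) := by
        gcongr
        exact h.sum_densityEntropy_blockMean_le hU hπ hM hlam
    _ = (1 - lamStar / M) * densityEntropy π f := by
        field_simp

end Contraction

/-! ### Mixing from a warm start -/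

section Warm

variable {M : ℕ} {d : Fin M → ℕ} {π : Measure (BlockSpace d)} [IsProbabilityMeasure π]
  {U U₀ : BlockSpace d → ℝ} {V : (m : Fin M) → EuclideanSpace ℝ (Fin (d m)) → ℝ}
  {Lb : Fin M → ℝ} {lamStar C : ℝ}

theorem IsBoundedDensity.exists_gibbsLaw_eq {f : BlockSpace d → ℝ≥0∞}
    (h : IsBoundedDensity π C f) (hU : IsBlockConvexSmooth U U₀ V Lb lamStar)
    (hπ : π = (volume : Measure (BlockSpace d)).withDensity
      (fun x => ENNReal.ofReal (Real.exp (-U x)))) (hM : 1 ≤ M) (hlam : lamStar ≤ 1) (n : ℕ) :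
    ∃ g, IsBoundedDensity π C g ∧ gibbsLaw π (π.withDensity f) n = π.withDensity g ∧
      densityEntropy π g ≤ (1 - lamStar / M) ^ n * densityEntropy π f := by
  induction n with
  | zero => exact ⟨f, h, rfl, by simp⟩
  | succ n ih =>
    obtain ⟨g, hg, hgeq, hgle⟩ := ih
    refine ⟨_root_.gibbsMean π g, hg.gibbsMean hM, ?_, ?_⟩
    · rw [gibbsLaw, hgeq, bind_gibbsKernel_withDensity hg.measurable]
    · have hM' : (1 : ℝ) ≤ M := by exact_mod_cast hM
      have h0 : 0 ≤ 1 - lamStar / M := by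
        rw [sub_nonneg, div_le_one (by linarith)]
        linarith
      calc densityEntropy π (_root_.gibbsMean π g)
          ≤ (1 - lamStar / M) * densityEntropy π g :=
            hg.densityEntropy_gibbsMean_le hU hπ hM hlam
        _ ≤ (1 - lamStar / M) * ((1 - lamStar / M) ^ n * densityEntropy π f) := by gcongr
        _ = (1 - lamStar / M) ^ (n + 1) * densityEntropy π f := by ring

theorem one_le_of_forall_measure_le {X : Type*} [MeasurableSpace X] {μ ν : Measure X}
    [IsProbabilityMeasure μ] [IsProbabilityMeasure ν]
    (h : ∀ A, MeasurableSet A → μ A ≤ ENNReal.ofReal C * ν A) : 1 ≤ C := by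
  simpa using h Set.univ MeasurableSet.univ

theorem IsBlockConvexSmooth.klDiv_gibbsLaw_le_of_warm_start
    (hU : IsBlockConvexSmooth U U₀ V Lb lamStar)
    (hπ : π = (volume : Measure (BlockSpace d)).withDensity
      (fun x => ENNReal.ofReal (Real.exp (-U x)))) (hM : 1 ≤ M) (hd : ∀ m, 1 ≤ d m)
    {ε : ℝ} (hε : 0 < ε) {μ₀ : Measure (BlockSpace d)} [IsProbabilityMeasure μ₀]
    (hC : ∀ A, MeasurableSet A → μ₀ A ≤ ENNReal.ofReal C * π A) {n : ℕ}
    (hn : C = 1 ∨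
      (1 / lamStar) * M * (Real.log (1 / ε) + Real.log (Real.log C)) ≤ (n : ℝ)) :
    InformationTheory.klDiv (gibbsLaw π μ₀ n) π ≤ ENNReal.ofReal ε := by
  have hlam : lamStar ≤ 1 := hU.lamStar_le_one ⟨0, hM⟩ (hd _)
  have hlam0 := hU.lamStar_pos
  have hM' : (1 : ℝ) ≤ M := by exact_mod_cast hM
  have hM0 : (0 : ℝ) < M := by linarith
  have hC1 : 1 ≤ C := one_le_of_forall_measure_le hC
  obtain ⟨f, hf, rfl⟩ := IsBoundedDensity.exists_of_le hC
  obtain ⟨g, hg, hgeq, hgle⟩ := hf.exists_gibbsLaw_eq hU hπ hM hlam n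
  rw [hgeq, hg.klDiv_eq]
  refine ENNReal.ofReal_le_ofReal ?_
  have h0 : 0 ≤ 1 - lamStar / M := by
    rw [sub_nonneg, div_le_one hM0]
    linarith
  have hle : densityEntropy π g ≤ (1 - lamStar / M) ^ n * Real.log C := by
    refine hgle.trans ?_
    gcongr
    exact hf.densityEntropy_le
  -- At C = 1 the entropy bound is already 0. The case is separate since `Real.log 0 = 0` does not
  -- encode the convention log 0 = -∞.
  rcases hC1.eq_or_lt with h1 | h1
  · rw [← h1, Real.log_one, mul_zero] at hle
    linarith
  have hlogC : 0 < Real.log C := Real.log_pos h1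
  have hn' := hn.resolve_left h1.ne'
  have hpow : (1 - lamStar / M) ^ n ≤ Real.exp (-(lamStar / M * n)) := by
    calc (1 - lamStar / M) ^ n ≤ Real.exp (-(lamStar / M)) ^ n := by
          gcongr
          exact Real.one_sub_le_exp_neg _
      _ = Real.exp (-(lamStar / M * n)) := by
          rw [← Real.exp_nat_mul]; ring_nf
  have hkey : Real.log (Real.log C / ε) ≤ lamStar / M * n := by
    rw [Real.log_div hlogC.ne' hε.ne']
    have h2 := mul_le_mul_of_nonneg_left hn' (by positivity : 0 ≤ lamStar / M)
    rw [one_div ε, Real.log_inv] at h2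
    have h3 : lamStar / M * (1 / lamStar * M * (-Real.log ε + Real.log (Real.log C))) =
        -Real.log ε + Real.log (Real.log C) := by field_simp
    linarith
  calc densityEntropy π g ≤ (1 - lamStar / M) ^ n * Real.log C := hle
    _ ≤ Real.exp (-(lamStar / M * n)) * Real.log C := by gcongr
    _ ≤ Real.exp (-Real.log (Real.log C / ε)) * Real.log C := by gcongr
    _ = ε := by
        rw [Real.exp_neg, Real.exp_log (by positivity)]
        field_simp

end Warm

/-! ### The Gaussian start -/

section Gaussian

variable {M : ℕ} {d : Fin M → ℕ}

theorem finrank_blockSpace : Module.finrank ℝ (BlockSpace d) = ∑ m, d m := by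
  rw [(WithLp.linearEquiv 2 ℝ ((m : Fin M) → EuclideanSpace ℝ (Fin (d m)))).finrank_eq,
    Module.finrank_pi_fintype]
  simp

theorem integrable_exp_neg_mul_norm_sub_sq {E : Type*} [NormedAddCommGroup E]
    [InnerProductSpace ℝ E] [FiniteDimensional ℝ E] [MeasurableSpace E] [BorelSpace E] {b : ℝ}
    (hb : 0 < b) (c : E) :
    Integrable (fun x : E => Real.exp (-b * ‖x - c‖ ^ 2)) ∧
      ∫ x : E, Real.exp (-b * ‖x - c‖ ^ 2) = (Real.pi / b) ^ ((Module.finrank ℝ E : ℝ) / 2) := by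
  have h : ∫ x : E, Real.exp (-b * ‖x - c‖ ^ 2) =
      (Real.pi / b) ^ ((Module.finrank ℝ E : ℝ) / 2) := by
    rw [integral_sub_right_eq_self (fun x : E => Real.exp (-b * ‖x‖ ^ 2)) c,
      GaussianFourier.integral_rexp_neg_mul_sq_norm hb]
  refine ⟨Integrable.of_integral_ne_zero ?_, h⟩
  rw [h]
  have := Real.pi_pos
  positivity

instance (c : BlockSpace d) (L : ℝ) : IsProbabilityMeasure (isotropicGaussian c L) := by
  unfold isotropicGaussian
  exact Measure.isProbabilityMeasure_map (by fun_prop)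

/-- Both measures are finite and have the same characteristic function, by the Gaussian Fourier
integral. -/
theorem isotropicGaussian_eq_withDensity (c : BlockSpace d) {L : ℝ} (hL : 0 < L) :
    isotropicGaussian c L = (volume : Measure (BlockSpace d)).withDensity fun x =>
      ENNReal.ofReal (((Real.pi / (L / 2)) ^ ((Module.finrank ℝ (BlockSpace d) : ℝ) / 2))⁻¹ *
        Real.exp (-(L / 2) * ‖x - c‖ ^ 2)) := by
  set b := L / 2 with hb
  have hb0 : 0 < b := half_pos hL
  have hpi := Real.pi_pos
  set Z := (Real.pi / b) ^ ((Module.finrank ℝ (BlockSpace d) : ℝ) / 2) with hZ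
  have hZ0 : 0 < Z := by positivity
  have hint := (integrable_exp_neg_mul_norm_sub_sq hb0 c).1.const_mul Z⁻¹
  have hfin := isFiniteMeasure_withDensity_ofReal hint.2
  refine Measure.ext_of_charFun (funext fun t => ?_)
  have hmap : isotropicGaussian c L =
      ((stdGaussian (BlockSpace d)).map fun z => (Real.sqrt L)⁻¹ • z).map fun z => c + z := by
    rw [Measure.map_map (by fun_prop) (by fun_prop)]
    rfl
  rw [hmap, charFun_map_const_add, charFun_map_smul, charFun_stdGaussian, charFun_apply,
    integral_withDensity_eq_integral_toReal_smul (by fun_prop)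
      (Filter.Eventually.of_forall fun _ => ENNReal.ofReal_lt_top)]
  have h1 : ∀ x : BlockSpace d,
      (ENNReal.ofReal (Z⁻¹ * Real.exp (-b * ‖x - c‖ ^ 2))).toReal •
        Complex.exp ((inner ℝ x t : ℝ) * Complex.I) =
      (Z : ℂ)⁻¹ * Complex.exp ((inner ℝ c t : ℝ) * Complex.I) *
        Complex.exp (-(b : ℂ) * (‖x - c‖ : ℂ) ^ 2 + Complex.I * (inner ℝ t (x - c) : ℝ)) := by
    intro x
    rw [ENNReal.toReal_ofReal (by positivity), Complex.real_smul, inner_sub_right,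
      real_inner_comm t x, real_inner_comm t c, mul_assoc, ← Complex.exp_add]
    push_cast
    rw [mul_assoc, ← Complex.exp_add]
    congr 2
    ring
  simp_rw [h1]
  rw [integral_const_mul, integral_sub_right_eq_self (fun x : BlockSpace d =>
      Complex.exp (-(b : ℂ) * (‖x‖ : ℂ) ^ 2 + Complex.I * (inner ℝ t x : ℝ))) c,
    GaussianFourier.integral_cexp_neg_mul_sq_norm_add (by simpa using hb0)]
  have h2 : ((Real.pi : ℂ) / b) ^ ((Module.finrank ℝ (BlockSpace d) : ℂ) / 2) = (Z : ℂ) := by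
    rw [hZ, Complex.ofReal_cpow (by positivity)]
    push_cast
    rfl
  rw [h2, norm_smul, Complex.I_sq, mul_comm (Complex.exp _), mul_assoc, mul_left_comm]
  have hZc : (Z : ℂ) ≠ 0 := by exact_mod_cast hZ0.ne'
  rw [inv_mul_cancel_left₀ hZc]
  congr 2
  have hL' : (L : ℂ) ≠ 0 := by exact_mod_cast hL.ne'
  have h3 : ((‖(Real.sqrt L)⁻¹‖ * ‖t‖ : ℝ) : ℂ) ^ 2 = (L : ℂ)⁻¹ * (‖t‖ : ℂ) ^ 2 := by
    rw [← Complex.ofReal_pow, mul_pow, norm_inv, inv_pow, Real.norm_eq_abs, sq_abs,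
      Real.sq_sqrt hL.le]
    push_cast
    rfl
  rw [h3, hb]
  push_cast
  field_simp
  ring

/-- Smoothness at the minimizer c bounds the Gaussian exponential by e^{U(c) - U(x)}; strong
convexity and total mass 1 bound e^{U(c)} by (2π/λ)^(d/2). Dividing by the normalisation
(2π/L)^(d/2) leaves (L/λ)^(d/2). -/
theorem IsConvexSmooth.isotropicGaussian_le {U : BlockSpace d → ℝ} {L lam : ℝ}
    (h : IsConvexSmooth U L lam) (hlam : lam ≤ L) {π : Measure (BlockSpace d)}
    [IsProbabilityMeasure π]
    (hπ : π = (volume : Measure (BlockSpace d)).withDensity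
      (fun x => ENNReal.ofReal (Real.exp (-U x)))) {c : BlockSpace d} (hc : ∀ y, U c ≤ U y)
    (A : Set (BlockSpace d)) (hA : MeasurableSet A) :
    isotropicGaussian c L A ≤
      ENNReal.ofReal ((L / lam) ^ (((∑ m, d m : ℕ) : ℝ) / 2)) * π A := by
  have hlam0 := h.lam_pos
  have hL : 0 < L := hlam0.trans_le hlam
  have hpi := Real.pi_pos
  set D : ℝ := (Module.finrank ℝ (BlockSpace d) : ℝ) / 2 with hD
  have hD' : ((∑ m, d m : ℕ) : ℝ) / 2 = D := by rw [hD, finrank_blockSpace]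
  have hUm : Measurable fun x => ENNReal.ofReal (Real.exp (-U x)) :=
    (Real.measurable_exp.comp h.smooth.1.continuous.measurable.neg).ennreal_ofReal
  have hmass : Real.exp (U c) ≤ (Real.pi / (lam / 2)) ^ D := by
    obtain ⟨hint, hval⟩ := integrable_exp_neg_mul_norm_sub_sq (half_pos hlam0) c
    have h1 : ∫⁻ x, ENNReal.ofReal (Real.exp (-U x)) = 1 := by
      have : π Set.univ = 1 := measure_univ
      rwa [hπ, withDensity_apply _ MeasurableSet.univ, Measure.restrict_univ] at this
    have h2 : (1 : ℝ≥0∞) ≤ ENNReal.ofReal (Real.exp (-U c) * (Real.pi / (lam / 2)) ^ D) := by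
      rw [← h1, ← hval, ← integral_const_mul, ofReal_integral_eq_lintegral_ofReal
        (hint.const_mul _) (Filter.Eventually.of_forall fun x => by positivity)]
      refine lintegral_mono fun x => ENNReal.ofReal_le_ofReal ?_
      rw [← Real.exp_add]
      refine Real.exp_le_exp.2 ?_
      linarith [h.add_le_of_forall_le hc x]
    rw [ENNReal.one_le_ofReal, Real.exp_neg, inv_mul_eq_div, one_le_div (Real.exp_pos _)] at h2
    exact h2
  rw [isotropicGaussian_eq_withDensity c hL, hπ, withDensity_apply _ hA, withDensity_apply _ hA,
    ← lintegral_const_mul _ hUm, hD']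
  refine lintegral_mono fun x => ?_
  rw [← ENNReal.ofReal_mul (by positivity)]
  refine ENNReal.ofReal_le_ofReal ?_
  have h3 : Real.exp (-(L / 2) * ‖x - c‖ ^ 2) ≤ Real.exp (U c) * Real.exp (-U x) := by
    rw [← Real.exp_add]
    refine Real.exp_le_exp.2 ?_
    linarith [h.le_add_of_forall_le hc x]
  have h4 : ((Real.pi / (L / 2)) ^ D)⁻¹ * (Real.pi / (lam / 2)) ^ D = (L / lam) ^ D := by
    rw [← Real.inv_rpow (by positivity), ← Real.mul_rpow (by positivity) (by positivity)]
    congr 1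
    field_simp
  calc ((Real.pi / (L / 2)) ^ D)⁻¹ * Real.exp (-(L / 2) * ‖x - c‖ ^ 2)
      ≤ ((Real.pi / (L / 2)) ^ D)⁻¹ * ((Real.pi / (lam / 2)) ^ D * Real.exp (-U x)) := by
        gcongr
        exact h3.trans (by gcongr)
    _ = (L / lam) ^ D * Real.exp (-U x) := by rw [← mul_assoc, h4]

end Gaussian

end

/-! ### The two mixing-time bounds -/

theorem mainTheorem10 {M : ℕ} (hM : 1 ≤ M) (d : Fin M → ℕ) (hd : ∀ m, 1 ≤ d m)
    (U : BlockSpace d → ℝ) (π : Measure (BlockSpace d)) [IsProbabilityMeasure π]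
    (hπ : π = (volume : Measure (BlockSpace d)).withDensity
      (fun x => ENNReal.ofReal (Real.exp (-U x))))
    (ε : ℝ) (hε : 0 < ε) :
    -- (a) warm start
    (∀ (U₀ : BlockSpace d → ℝ) (V : (m : Fin M) → EuclideanSpace ℝ (Fin (d m)) → ℝ)
        (Lb : Fin M → ℝ) (lamStar : ℝ), IsBlockConvexSmooth U U₀ V Lb lamStar →
      ∀ (μ₀ : Measure (BlockSpace d)), IsProbabilityMeasure μ₀ →
      ∀ C : ℝ, (∀ A, MeasurableSet A → μ₀ A ≤ ENNReal.ofReal C * π A) →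
      ∀ n : ℕ,
        (C = 1 ∨ (1 / lamStar) * M * (Real.log (1 / ε) + Real.log (Real.log C)) ≤ (n : ℝ)) →
        InformationTheory.klDiv (gibbsLaw π μ₀ n) π ≤ ENNReal.ofReal ε) ∧
    -- (b) feasible start
    (∀ L lam : ℝ, IsConvexSmooth U L lam →
      -- the mode is well defined
      (∃! x, ∀ y, U x ≤ U y) ∧
      -- the block-wise assumption holds, with a coordinate-wise condition number in `[1, κ]`
      (∃ (U₀ : BlockSpace d → ℝ) (V : (m : Fin M) → EuclideanSpace ℝ (Fin (d m)) → ℝ)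
        (Lb : Fin M → ℝ) (lamStar : ℝ), IsBlockConvexSmooth U U₀ V Lb lamStar ∧
          1 ≤ 1 / lamStar ∧ 1 / lamStar ≤ L / lam) ∧
      -- mixing time bound
      ∀ xstar : BlockSpace d, (∀ y, U xstar ≤ U y) →
      ∀ (U₀ : BlockSpace d → ℝ) (V : (m : Fin M) → EuclideanSpace ℝ (Fin (d m)) → ℝ)
        (Lb : Fin M → ℝ) (lamStar : ℝ), IsBlockConvexSmooth U U₀ V Lb lamStar →
      ∀ n : ℕ,
        (L / lam = 1 ∨
          (1 / lamStar) * M *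
            (Real.log (1 / ε) + Real.log (((∑ m, d m : ℕ) : ℝ) * Real.log (L / lam) / 2))
              ≤ (n : ℝ)) →
        InformationTheory.klDiv (gibbsLaw π (isotropicGaussian xstar L) n) π
          ≤ ENNReal.ofReal ε) := by
  have hnt : Nontrivial (BlockSpace d) := by
    rw [← Module.finrank_pos_iff (R := ℝ), finrank_blockSpace]
    exact Finset.sum_pos (fun m _ => hd m) ⟨⟨0, hM⟩, Finset.mem_univ _⟩
  refine ⟨fun U₀ V Lb lamStar hU μ₀ hμ₀ C hC n hn =>
    hU.klDiv_gibbsLaw_le_of_warm_start hπ hM hd hε hC hn, fun L lam h => ?_⟩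
  have hlam0 := h.lam_pos
  have hlam := h.lam_le
  have hL : 0 < L := hlam0.trans_le hlam
  refine ⟨h.existsUnique_forall_le,
    ⟨U, fun _ _ => 0, fun _ => L, lam / L, h.isBlockConvexSmooth, ?_, ?_⟩,
    fun xstar hx U₀ V Lb lamStar hU n hn => ?_⟩
  · rw [one_div_div, one_le_div hlam0]
    exact hlam
  · rw [one_div_div]
  · refine hU.klDiv_gibbsLaw_le_of_warm_start hπ hM hd hε (h.isotropicGaussian_le hlam hπ hx) ?_
    -- With C = κ^(d/2), log C is (d/2) log κ, and κ = 1 gives C = 1.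
    rw [Real.log_rpow (div_pos hL hlam0)]
    rcases hn with hn | hn
    · left
      rw [hn, Real.one_rpow]
    · right
      rwa [div_mul_eq_mul_div ((∑ m, d m : ℕ) : ℝ)]
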